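/- Let $\beta(s)=\sum_{n\ge1}\frac{(-1)^{n-1}}{(2n-1)^s}$ for integers $s\ge1$, and let $\mathrm{Li}_{s_1,\dots,s_r}(x_1,\dots,x_r)=\sum_{m_1>\cdots>m_r>0}\frac{x_1^{m_1}\cdots x_r^{m_r}}{m_1^{s_1}\cdots m_r^{s_r}}$. For signs $\sigma_i\in\{\pm1\}$ and integers $s_i\ge1$ let $$T^{\sigma_1,\dots,\sigma_r}(s_1,\dots,s_r)=\sum_{m_1>\cdots>m_r>0}\ \prod_{j=1}^r\frac{(1+\varepsilon_j(-1)^{m_j})\,\sigma_j^{(2m_j+1-\varepsilon_j)/4}}{m_j^{s_j}},\qquad \varepsilon_j=(-1)^{r-j+1},$$ (so $m_r$ is odd, $m_{r-1}$ is even, and so on alternately; summands violating these parity conditions are zero). All these infinite sums are understood as limits for $N\to\infty$ of their truncations to $m_1\le N$ (respectively $n\le N$). As usual a bar over $s_j$ means $\sigma_j=-1$, no bar means $\sigma_j=1$, and $\{1\}_{m-1}$ is the string $1,\dots,1$ of length $m-1$. Theorem. For every integer $m\ge1$ (odd or even) all the series occurring below converge, and $$\begin{aligned} T(\overline2,\{1\}_{m-1},\overline1)=\mathrm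 i^{\delta_{m\text{ even}}}\Big[&\sum_{\substack{k+p+r=m\\ k,p,r\ge0}}4\,\mathrm i\,(-1)^{p+1}\beta(r+1)\beta(p+1)\frac1{k!}\Big(\frac{\mathrm i\pi}2\Big)^k\\ &+\sum_{\substack{r+p=m\\ r,p\ge0}}2(-1)^{1+p}\beta(r+1)\big(\mathrm{Li}_{p+1}(-1)-\delta_{p\ge1}\mathrm{Li}_{p+1}(1)\big)+2\beta(m+2)\\ &-2\,\mathrm{Im}\big(\mathrm{Li}_{1,m+1}(-1,\mathrm i)+\mathrm{Li}_{m+1,1}(-\mathrm i,1)+\mathrm{Li}_{1,m+1}(\mathrm i,-\mathrm i)+\mathrm{Li}_{1,m+1}(-\mathrm i,-\mathrm i)\big)\Big], \end{aligned}$$ where $\mathrm i^{\delta_{m\text{ even}}}$ is $\mathrm i$ for even $m$ and $1$ for odd $m$, and the term $\delta_{p\ge1}\mathrm{Li}_{p+1}(1)$ is $\mathrm{Li}_{p+1}(1)=\zeta(p+1)$ for $p\ge1$ and is absent for $p=0$. -/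

import Mathlib

open Filter Topology

namespace MixedValues

noncomputable section

/-- The truncated nested sum `∑_{N ≥ m₁ > m₂ > ⋯ > mᵣ > 0} f₁(m₁) f₂(m₂) ⋯ fᵣ(mᵣ)`, where
`[f₁, …, fᵣ]` is the given list; it is `1` for the empty list. -/
def nestedSum {R : Type*} [CommSemiring R] : List (ℕ → R) → ℕ → R
  | [], _ => 1
  | f :: fs, N => ∑ n ∈ Finset.Icc 1 N, f n * nestedSum fs (n - 1)

/-- The infinite nested sum over `m₁ > m₂ > ⋯ > mᵣ > 0` converges, as a limit of the truncations
`m₁ ≤ N`. -/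
def NestedConverges {R : Type*} [CommSemiring R] [TopologicalSpace R]
    (fs : List (ℕ → R)) : Prop :=
  ∃ L : R, Tendsto (nestedSum fs) atTop (𝓝 L)

/-- The value of the infinite nested sum over `m₁ > m₂ > ⋯ > mᵣ > 0`, as the limit of the
truncations `m₁ ≤ N` (to be used where `NestedConverges` holds). -/
def nestedLim {R : Type*} [CommSemiring R] [TopologicalSpace R] (fs : List (ℕ → R)) : R :=
  haveI : Nonempty R := ⟨1⟩
  limUnder atTop (nestedSum fs)

/-- One factor `(1 + ε (-1)^n) σ^((2n + 1 - ε)/4) / n^s` of an alternating multiple mixed value,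
for a parity `ε` (`1` is even, `-1` is odd), a sign `σ` and an exponent `s`. The integer division
is exact whenever `1 + ε (-1)^n ≠ 0`. -/
def mixedTerm (ε σ : ℤˣ) (s : ℕ) (n : ℕ) : ℝ :=
  (1 + ((ε : ℤ) : ℝ) * (-1) ^ n) * (((σ : ℤ) : ℝ) ^ ((2 * (n : ℤ) + 1 - (ε : ℤ)) / 4)) / (n : ℝ) ^ s

/-- The factors of the alternating multiple `T`-value `T^{σ₁,…,σᵣ}(s₁,…,sᵣ)`, for the list of
pairs `(σᵢ, sᵢ)`: the parities alternate and the last one is odd. -/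
def altTTerms : List (ℤˣ × ℕ) → List (ℕ → ℝ)
  | [] => []
  | (σ, s) :: l => mixedTerm ((-1) ^ (l.length + 1)) σ s :: altTTerms l

/-- The alternating multiple `T`-value `T^{σ₁,…,σᵣ}(s₁,…,sᵣ)`, for the list of pairs
`(σᵢ, sᵢ)`; a sign `-1` is a bar over the argument. -/
def altT (l : List (ℤˣ × ℕ)) : ℝ := nestedLim (altTTerms l)

/-- The index `(2̄, {1}_{m-1}, 1̄)`. -/
def index21 (m : ℕ) : List (ℤˣ × ℕ) :=
  (-1, 2) :: (List.replicate (m - 1) (1, 1) ++ [(-1, 1)])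

/-- The factors `n ↦ xᵢ^n / n^{sᵢ}` of the multiple polylogarithm, for the list of pairs
`(sᵢ, xᵢ)`. -/
def polylogTerms (l : List (ℕ × ℂ)) : List (ℕ → ℂ) :=
  l.map fun q n => q.2 ^ n / (n : ℂ) ^ q.1

/-- The depth one polylogarithm `Li_s(x) = ∑_{n > 0} x^n / n^s`. -/
def Li₁ (s : ℕ) (x : ℂ) : ℂ := nestedLim (polylogTerms [(s, x)])

/-- The depth two polylogarithm `Li_{s,t}(x,y) = ∑_{n > k > 0} x^n y^k / (n^s k^t)`. -/
def Li₂ (s t : ℕ) (x y : ℂ) : ℂ := nestedLim (polylogTerms [(s, x), (t, y)])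

/-- The factor of the Dirichlet beta series. -/
def betaTerm (s : ℕ) (n : ℕ) : ℝ := (-1) ^ (n - 1) / (2 * (n : ℝ) - 1) ^ s

/-- The Dirichlet beta value `β(s) = ∑_{n ≥ 1} (-1)^(n-1) / (2n-1)^s` at an integer `s ≥ 1`. -/
def dirichletBeta (s : ℕ) : ℝ := nestedLim [betaTerm s]

end

end MixedValues

open MixedValues

/-!
The value `T(2̄, {1}_{m-1}, 1̄)` is reduced to a single integral, which is then expanded in cosines.

**From the nested sum to an integral.** Summing the tail `({1}_j, 1̄)` of the index against `y^n`,
with the signs that `i^n` produces on the imaginary axis, gives functions `g_j` with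
`(1 - y²) g_0' = 2` and `(1 + y²) g_{j+1}' = ± 2 g_j`. In the coordinate `b = 2 arctan y` they are,
up to sign, the iterated antiderivatives of `1 / cos b` (`angleFun_eq_integral`). The entry `2̄`
contributes a last integration against `dy / y = db / sin b`, so that up to sign the value is
`∫∫_{0 < a < b < π/2} (b - a)^m / (m! cos a sin b)`. The substitution `c = b - a` and an elementary
integration over `a` leave `∫₀^{π/2} c^m / m! · f(c) dc` with `f(c) = -2 log (sin c) / cos c`
(`lintegral_triangleKer_eq`).

**From the integral to single series.** The same function is
`f(c) = 4 ∫₀¹ (1 - x) cos c / ((1 + x) (1 - 2 x cos 2c + x²)) dx`, and the geometric series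
`∑ x^l cos((2l+1)c)` turns the integral into `4 ∑ α_l ∫ c^m / m! cos((2l+1)c) dc`
with `α_l = ∫₀¹ x^l / (1 + x) dx` (`altT_index21`). The kernels are nonnegative, so the integrals
are exchanged by Tonelli's theorem. Since `cos((2l+1)c)` vanishes at `π/2`, the moments are explicit
(`I_pow_mul_cosMoment`).

**Identification with the right-hand side.** By partial fractions,
`∑_{p+r=b} (-1)^p β(r+1) β(p+1)` is a multiple of `∑ (-1)^l α_l / (2l+1)^(b+1)`
(`sum_antidiagonal_beta_mul_beta`); this accounts for the triple sum over `k + p + r = m`. The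
products of `β(r+1)` with `Li_{p+1}(±1)` are treated in the same way
(`sum_antidiagonal_beta_mul_oddZeta`), the four polylogarithms of depth two are summed over their
outer index (`im_polylog_eq`), and all that remains of these terms is a multiple of
`∑ α_l / (2l+1)^(m+1)` (`sum_beta_mul_Li_add`), which comes from the other endpoint of the moments.
-/

namespace MixedValues

open Finset MeasureTheory

/-! ### The tails of the alternating harmonic series -/

/-- The tails `α_l = ∑_{i ≥ 0} (-1)^i / (l + i + 1)` of the alternating harmonic series, in the
form `∫₀¹ x^l / (1 + x) dx`. In particular `α_0 = log 2`. -/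
noncomputable def alpha (l : ℕ) : ℝ := ∫ x in (0 : ℝ)..1, x ^ l / (1 + x)

lemma intervalIntegrable_pow_div_one_add (l : ℕ) :
    IntervalIntegrable (fun x : ℝ => x ^ l / (1 + x)) volume 0 1 := by
  apply ContinuousOn.intervalIntegrable
  rw [Set.uIcc_of_le zero_le_one]
  refine ContinuousOn.div (by fun_prop) (by fun_prop) fun x hx => ?_
  have := hx.1
  positivity

lemma alpha_nonneg (l : ℕ) : 0 ≤ alpha l :=
  intervalIntegral.integral_nonneg zero_le_one fun x hx => by
    have := hx.1
    positivity

lemma alpha_add_alpha_succ (l : ℕ) : alpha l + alpha (l + 1) = 1 / ((l : ℝ) + 1) := by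
  rw [alpha, alpha, ← intervalIntegral.integral_add (intervalIntegrable_pow_div_one_add l)
    (intervalIntegrable_pow_div_one_add (l + 1))]
  rw [show 1 / ((l : ℝ) + 1) = ∫ x in (0 : ℝ)..1, x ^ l by simp]
  refine intervalIntegral.integral_congr fun x hx => ?_
  rw [Set.uIcc_of_le zero_le_one] at hx
  have : 1 + x ≠ 0 := by linarith [hx.1]
  field_simp
  ring

lemma alpha_le (l : ℕ) : alpha l ≤ 1 / ((l : ℝ) + 1) := by
  linarith [alpha_add_alpha_succ l, alpha_nonneg (l + 1)]

lemma sum_range_alternating_eq_alpha (l n : ℕ) :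
    ∑ i ∈ range n, (-1 : ℝ) ^ i / ((l : ℝ) + i + 1) = alpha l - (-1) ^ n * alpha (l + n) := by
  induction n with
  | zero => simp
  | succ n ih =>
    have h := alpha_add_alpha_succ (l + n)
    push_cast at h
    rw [sum_range_succ, ih, div_eq_mul_one_div, ← h, pow_succ, ← add_assoc l n 1]
    ring

lemma abs_sum_range_alternating_le (l n : ℕ) :
    |∑ i ∈ range n, (-1 : ℝ) ^ i / ((l : ℝ) + i + 1)| ≤ 2 / ((l : ℝ) + 1) := by
  rw [sum_range_alternating_eq_alpha]
  have h1 := alpha_le l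
  have h2 := alpha_le (l + n)
  have h3 : 1 / (((l + n : ℕ) : ℝ) + 1) ≤ 1 / ((l : ℝ) + 1) := by
    push_cast
    gcongr
    linarith [(Nat.cast_nonneg n : (0 : ℝ) ≤ n)]
  calc |alpha l - (-1) ^ n * alpha (l + n)| ≤ |alpha l| + |(-1) ^ n * alpha (l + n)| :=
        abs_sub _ _
    _ = alpha l + alpha (l + n) := by
        rw [abs_mul, abs_pow, abs_neg, abs_one, one_pow, one_mul, abs_of_nonneg (alpha_nonneg _),
          abs_of_nonneg (alpha_nonneg _)]
    _ ≤ 1 / ((l : ℝ) + 1) + 1 / ((l : ℝ) + 1) := by linarith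
    _ = 2 / ((l : ℝ) + 1) := by ring

lemma tendsto_alpha_zero : Tendsto alpha atTop (𝓝 0) :=
  squeeze_zero alpha_nonneg alpha_le tendsto_one_div_add_atTop_nhds_zero_nat

lemma tendsto_sum_range_alternating (l : ℕ) :
    Tendsto (fun n => ∑ i ∈ range n, (-1 : ℝ) ^ i / ((l : ℝ) + i + 1)) atTop (𝓝 (alpha l)) := by
  simp_rw [sum_range_alternating_eq_alpha]
  have h : Tendsto (fun n => (-1 : ℝ) ^ n * alpha (l + n)) atTop (𝓝 0) := by
    refine squeeze_zero_norm (a := fun n => alpha (l + n)) (fun n => ?_)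
      (tendsto_alpha_zero.comp (tendsto_add_atTop_nat l |>.congr fun n => add_comm _ _))
    rw [norm_mul, norm_pow, norm_neg, norm_one, one_pow, one_mul,
      Real.norm_of_nonneg (alpha_nonneg _)]
  simpa using h.const_sub (alpha l)

/-! ### Products of beta values by partial fractions -/

/-- The `l`-th harmonic number as a real number. -/
noncomputable def harm (l : ℕ) : ℝ := ∑ i ∈ range l, 1 / ((i : ℝ) + 1)

lemma harm_nonneg (l : ℕ) : 0 ≤ harm l := sum_nonneg fun i _ => by positivity

lemma harm_mono : Monotone harm := fun a b h =>
  sum_le_sum_of_subset_of_nonneg (range_subset_range.2 h) fun i _ _ => by positivity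

/-- Truncations of `β(s)`. -/
noncomputable def betaSum (s N : ℕ) : ℝ := ∑ i ∈ range N, (-1 : ℝ) ^ i / (2 * (i : ℝ) + 1) ^ s

lemma exists_tendsto_betaSum (s : ℕ) (hs : 1 ≤ s) :
    ∃ L, Tendsto (betaSum s) atTop (𝓝 L) := by
  have := Antitone.tendsto_alternating_series_of_tendsto_zero
    (f := fun i : ℕ => 1 / (2 * (i : ℝ) + 1) ^ s) (fun a b h => by
      have : (a : ℝ) ≤ b := by exact_mod_cast h
      dsimp only
      gcongr) (by
      have h1 : Tendsto (fun i : ℕ => 2 * (i : ℝ) + 1) atTop atTop :=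
        tendsto_atTop_add_const_right _ _
          (tendsto_natCast_atTop_atTop.const_mul_atTop (by norm_num))
      have := (tendsto_pow_atTop (α := ℝ) (n := s) (by omega)).comp h1
      exact this.inv_tendsto_atTop.congr fun i => by simp)
  obtain ⟨L, hL⟩ := this
  refine ⟨L, hL.congr fun n => sum_congr rfl fun i _ => by ring⟩

lemma nestedSum_betaTerm (s N : ℕ) : nestedSum [betaTerm s] N = betaSum s N := by
  simp only [nestedSum, mul_one, betaSum, betaTerm]
  rw [← Finset.Ico_add_one_right_eq_Icc, sum_Ico_eq_sum_range]
  refine sum_congr (by simp) fun i _ => ?_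
  simp only [Nat.add_sub_cancel_left]
  push_cast
  ring_nf

lemma nestedLim_eq {R : Type*} [CommSemiring R] [TopologicalSpace R] [T2Space R]
    {fs : List (ℕ → R)} {L : R} (h : Tendsto (nestedSum fs) atTop (𝓝 L)) : nestedLim fs = L :=
  h.limUnder_eq

lemma tendsto_betaSum (s : ℕ) (hs : 1 ≤ s) :
    Tendsto (betaSum s) atTop (𝓝 (dirichletBeta s)) := by
  obtain ⟨L, hL⟩ := exists_tendsto_betaSum s hs
  have h : dirichletBeta s = L := nestedLim_eq (hL.congr fun n => (nestedSum_betaTerm s n).symm)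
  rwa [h]

lemma nestedConverges_betaTerm (s : ℕ) (hs : 1 ≤ s) : NestedConverges [betaTerm s] := by
  obtain ⟨L, hL⟩ := exists_tendsto_betaSum s hs
  exact ⟨L, hL.congr fun n => (nestedSum_betaTerm s n).symm⟩

lemma harm_le_two_mul_sqrt (l : ℕ) : harm l ≤ 2 * √(l : ℝ) := by
  induction l with
  | zero => simp [harm]
  | succ l ih =>
    rw [harm, sum_range_succ, ← harm]
    have h0 : (0 : ℝ) ≤ l := Nat.cast_nonneg l
    have h1 := Real.sq_sqrt h0
    have h2 := Real.sq_sqrt (by positivity : (0 : ℝ) ≤ (l : ℝ) + 1)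
    have h3 := Real.sqrt_nonneg (l : ℝ)
    have h4 : √(l : ℝ) ≤ √((l : ℝ) + 1) := Real.sqrt_le_sqrt (by linarith)
    have h5 : 1 ≤ √((l : ℝ) + 1) := Real.one_le_sqrt.2 (by linarith)
    have h6 : 1 / ((l : ℝ) + 1) ≤ 2 * (√((l : ℝ) + 1) - √(l : ℝ)) := by
      rw [div_le_iff₀ (by positivity)]
      nlinarith [mul_nonneg (sub_nonneg.2 h4) (sub_nonneg.2 h5),
        mul_nonneg (sub_nonneg.2 h4) (sub_nonneg.2 h4)]
    push_cast
    linarith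

lemma summable_sqrt_div_sq : Summable fun l : ℕ => √((l : ℝ) + 1) / ((l : ℝ) + 1) ^ 2 := by
  have h := (summable_nat_add_iff 1).2
    (Real.summable_nat_rpow_inv.2 (by norm_num : (1 : ℝ) < 3 / 2))
  refine h.congr fun l => ?_
  have h0 : (0 : ℝ) < (l : ℝ) + 1 := by positivity
  push_cast
  rw [Real.sqrt_eq_rpow, ← Real.rpow_natCast, ← Real.rpow_sub h0, ← Real.rpow_neg h0.le]
  norm_num

lemma one_div_odd_pow_le (l s : ℕ) (hs : 2 ≤ s) :
    1 / (2 * (l : ℝ) + 1) ^ s ≤ 1 / ((l : ℝ) + 1) ^ 2 := by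
  have h0 : (0 : ℝ) ≤ l := Nat.cast_nonneg l
  gcongr
  calc ((l : ℝ) + 1) ^ 2 ≤ (2 * (l : ℝ) + 1) ^ 2 := by gcongr; linarith
    _ ≤ _ := pow_le_pow_right₀ (by linarith) hs

/-- Domination by `C √(l+1)` suffices for summation against `1 / (2l+1)^s` with `s ≥ 2`. -/
lemma summable_div_odd_pow {c : ℕ → ℝ} {C : ℝ} {s : ℕ} (hs : 2 ≤ s)
    (hc : ∀ l, |c l| ≤ C * √((l : ℝ) + 1)) :
    Summable fun l : ℕ => c l / (2 * (l : ℝ) + 1) ^ s := by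
  refine Summable.of_norm_bounded (summable_sqrt_div_sq.mul_left C) fun l => ?_
  have h := one_div_odd_pow_le l s hs
  rw [Real.norm_eq_abs, abs_div, abs_of_nonneg (by positivity : (0 : ℝ) ≤ (2 * (l : ℝ) + 1) ^ s)]
  calc |c l| / (2 * (l : ℝ) + 1) ^ s = |c l| * (1 / (2 * (l : ℝ) + 1) ^ s) := div_eq_mul_one_div _ _
    _ ≤ C * √((l : ℝ) + 1) * (1 / ((l : ℝ) + 1) ^ 2) :=
        mul_le_mul (hc l) h (by positivity) ((abs_nonneg _).trans (hc l))
    _ = C * (√((l : ℝ) + 1) / ((l : ℝ) + 1) ^ 2) := by ring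

lemma tendsto_sum_range_mul_of_dominated {𝕜 : Type*} [RCLike 𝕜] {g G : ℕ → 𝕜} {F : ℕ → ℕ → 𝕜}
    {C : ℕ → ℝ} (hs : Summable fun l => ‖g l‖ * C l) (hF : ∀ N l, ‖F N l‖ ≤ C l)
    (hG : ∀ l, Tendsto (fun N => F N l) atTop (𝓝 (G l))) :
    Tendsto (fun N => ∑ l ∈ range N, g l * F N l) atTop (𝓝 (∑' l, g l * G l)) := by
  have h := tendsto_tsum_of_dominated_convergence (𝓕 := atTop)
    (f := fun N l => if l < N then g l * F N l else 0) (g := fun l => g l * G l) hs (fun l => by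
      refine ((hG l).const_mul (g l)).congr' ?_
      filter_upwards [eventually_gt_atTop l] with N hN
      rw [if_pos hN]) (Eventually.of_forall fun N l => by
      split_ifs
      · rw [norm_mul]
        exact mul_le_mul_of_nonneg_left (hF N l) (norm_nonneg _)
      · rw [norm_zero]
        exact mul_nonneg (norm_nonneg _) ((norm_nonneg _).trans (hF N l)))
  refine h.congr fun N => ?_
  rw [tsum_eq_sum (s := range N) fun l hl => if_neg (by simpa using hl)]
  exact sum_congr rfl fun l hl => if_pos (by simpa using hl)

/-- Partial fractions for `1 / (k - z) · 1 / (n + z)`, read off at the coefficient of `z ^ b`. -/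
lemma sum_antidiagonal_partial_fractions {k n : ℝ} (hk : 0 < k) (hn : 0 < n) (b : ℕ) :
    ∑ q ∈ antidiagonal b, (-1) ^ q.1 * (1 / k ^ (q.2 + 1)) * (1 / n ^ (q.1 + 1)) =
      1 / (k + n) * (1 / k ^ (b + 1) + (-1) ^ b / n ^ (b + 1)) := by
  induction b with
  | zero =>
    simp
    field_simp
    ring
  | succ b ih =>
    have h : ∀ q ∈ antidiagonal b, (-1) ^ (q.1 + 1) * (1 / k ^ (q.2 + 1)) * (1 / n ^ (q.1 + 1 + 1))
        = (-1 / n) * ((-1) ^ q.1 * (1 / k ^ (q.2 + 1)) * (1 / n ^ (q.1 + 1))) := by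
      intro q _
      rw [pow_succ n (q.1 + 1)]
      field_simp
      ring
    rw [Nat.sum_antidiagonal_succ, sum_congr rfl h, ← mul_sum, ih]
    field_simp
    ring

lemma sum_range_alternating_half_eq (l N : ℕ) :
    ∑ i ∈ range N, (-1 : ℝ) ^ i / ((2 * (l : ℝ) + 1) + (2 * (i : ℝ) + 1)) =
      (∑ i ∈ range N, (-1 : ℝ) ^ i / ((l : ℝ) + i + 1)) / 2 := by
  rw [sum_div]
  refine sum_congr rfl fun i _ => ?_
  have : (0 : ℝ) < (l : ℝ) + i + 1 := by positivity
  field_simp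
  ring

/-- A product of two truncated beta values at total weight `b + 2`, by partial fractions. -/
lemma sum_antidiagonal_betaSum_mul_betaSum (b N : ℕ) :
    ∑ q ∈ antidiagonal b, (-1) ^ q.1 * betaSum (q.2 + 1) N * betaSum (q.1 + 1) N =
      (1 + (-1) ^ b) / 2 * ∑ l ∈ range N, ((-1) ^ l / (2 * (l : ℝ) + 1) ^ (b + 1) *
        ∑ i ∈ range N, (-1 : ℝ) ^ i / ((l : ℝ) + i + 1)) := by
  set S := ∑ l ∈ range N, ∑ i ∈ range N, (-1 : ℝ) ^ l / (2 * (l : ℝ) + 1) ^ (b + 1) *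
    ((-1 : ℝ) ^ i / ((2 * (l : ℝ) + 1) + (2 * (i : ℝ) + 1))) with hS
  have hR : ∑ l ∈ range N, ((-1) ^ l / (2 * (l : ℝ) + 1) ^ (b + 1) *
      ∑ i ∈ range N, (-1 : ℝ) ^ i / ((l : ℝ) + i + 1)) = 2 * S := by
    rw [hS, mul_sum]
    refine sum_congr rfl fun l _ => ?_
    rw [← mul_sum, sum_range_alternating_half_eq]
    ring
  have hS' : ∑ l ∈ range N, ∑ i ∈ range N, (-1 : ℝ) ^ i / (2 * (i : ℝ) + 1) ^ (b + 1) *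
      ((-1 : ℝ) ^ l / ((2 * (l : ℝ) + 1) + (2 * (i : ℝ) + 1))) = S := by
    rw [hS, sum_comm]
    refine sum_congr rfl fun l _ => sum_congr rfl fun i _ => ?_
    rw [add_comm (2 * (l : ℝ) + 1)]
  have key : ∑ q ∈ antidiagonal b, (-1) ^ q.1 * betaSum (q.2 + 1) N * betaSum (q.1 + 1) N =
      ∑ l ∈ range N, ∑ i ∈ range N, ((-1 : ℝ) ^ l * (-1 : ℝ) ^ i * ∑ q ∈ antidiagonal b,
        (-1) ^ q.1 * (1 / (2 * (l : ℝ) + 1) ^ (q.2 + 1)) *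
          (1 / (2 * (i : ℝ) + 1) ^ (q.1 + 1))) := by
    simp_rw [mul_sum]
    rw [sum_congr rfl fun l _ => sum_comm, sum_comm]
    refine sum_congr rfl fun q _ => ?_
    rw [mul_assoc, betaSum, betaSum, sum_mul_sum, mul_sum]
    refine sum_congr rfl fun l _ => ?_
    rw [mul_sum]
    refine sum_congr rfl fun i _ => ?_
    ring
  rw [hR, key, show (1 + (-1 : ℝ) ^ b) / 2 * (2 * S) = S + (-1) ^ b * S by ring]
  -- the second partial fraction is the first one with the roles of `l` and `i` exchanged
  nth_rewrite 2 [← hS']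
  rw [hS, mul_sum, ← sum_add_distrib]
  refine sum_congr rfl fun l _ => ?_
  rw [mul_sum, ← sum_add_distrib]
  refine sum_congr rfl fun i _ => ?_
  rw [sum_antidiagonal_partial_fractions (by positivity) (by positivity)]
  ring

lemma summable_alternating_alpha (b : ℕ) :
    Summable fun l : ℕ => (-1) ^ l / (2 * (l : ℝ) + 1) ^ (b + 1) * alpha l := by
  have h : Summable fun l : ℕ => 1 / ((l : ℝ) + 1) ^ 2 := by
    simpa using (summable_nat_add_iff 1).2 (Real.summable_one_div_nat_pow.2 (by norm_num : 1 < 2))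
  refine Summable.of_norm_bounded h fun l => ?_
  rw [norm_mul, norm_div, norm_pow, norm_neg, norm_one, one_pow,
    Real.norm_of_nonneg (by positivity), Real.norm_of_nonneg (alpha_nonneg l)]
  calc 1 / (2 * (l : ℝ) + 1) ^ (b + 1) * alpha l ≤ 1 / ((l : ℝ) + 1) * (1 / ((l : ℝ) + 1)) := by
        refine mul_le_mul ?_ (alpha_le l) (alpha_nonneg l) (by positivity)
        have h0 : (0 : ℝ) ≤ l := Nat.cast_nonneg l
        gcongr
        calc (l : ℝ) + 1 ≤ 2 * (l : ℝ) + 1 := by linarith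
          _ = (2 * (l : ℝ) + 1) ^ 1 := (pow_one _).symm
          _ ≤ _ := pow_le_pow_right₀ (by linarith) (by omega)
    _ = 1 / ((l : ℝ) + 1) ^ 2 := by field_simp

lemma summable_norm_div_odd_pow_mul_two_div (b : ℕ) :
    Summable fun l : ℕ => ‖(-1 : ℝ) ^ l / (2 * (l : ℝ) + 1) ^ (b + 1)‖ * (2 / ((l : ℝ) + 1)) := by
  have h : Summable fun l : ℕ => 2 * (1 / ((l : ℝ) + 1) ^ 2) := by
    simpa using ((summable_nat_add_iff 1).2
      (Real.summable_one_div_nat_pow.2 (by norm_num : 1 < 2))).mul_left 2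
  refine Summable.of_nonneg_of_le (fun l => by positivity) (fun l => ?_) h
  rw [norm_div, norm_pow, norm_neg, norm_one, one_pow, Real.norm_of_nonneg (by positivity)]
  have h0 : (0 : ℝ) ≤ l := Nat.cast_nonneg l
  calc 1 / (2 * (l : ℝ) + 1) ^ (b + 1) * (2 / ((l : ℝ) + 1))
      ≤ 1 / ((l : ℝ) + 1) * (2 / ((l : ℝ) + 1)) := by
        gcongr
        calc (l : ℝ) + 1 ≤ 2 * (l : ℝ) + 1 := by linarith
          _ = (2 * (l : ℝ) + 1) ^ 1 := (pow_one _).symm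
          _ ≤ _ := pow_le_pow_right₀ (by linarith) (by omega)
    _ = 2 * (1 / ((l : ℝ) + 1) ^ 2) := by field_simp

/-- The coefficients of `B(z) B(-z)`, where `B(z) = ∑ β(r+1) z^r`, as single series. -/
theorem sum_antidiagonal_beta_mul_beta (b : ℕ) :
    ∑ q ∈ antidiagonal b, (-1) ^ q.1 * dirichletBeta (q.2 + 1) * dirichletBeta (q.1 + 1) =
      (1 + (-1) ^ b) / 2 * ∑' l : ℕ, (-1) ^ l / (2 * (l : ℝ) + 1) ^ (b + 1) * alpha l := by
  refine tendsto_nhds_unique (tendsto_finsetSum _ fun q _ =>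
    ((tendsto_betaSum (q.2 + 1) (by omega)).const_mul _).mul
      (tendsto_betaSum (q.1 + 1) (by omega))) ?_
  simp_rw [sum_antidiagonal_betaSum_mul_betaSum]
  exact (tendsto_sum_range_mul_of_dominated (summable_norm_div_odd_pow_mul_two_div b)
    (fun N l => abs_sum_range_alternating_le l N) tendsto_sum_range_alternating).const_mul _

/-- The sum `∑ 1 / n^s` over odd `n`. -/
noncomputable def oddZeta (s : ℕ) : ℝ := ∑' i : ℕ, 1 / (2 * (i : ℝ) + 1) ^ s

lemma summable_oddZeta {s : ℕ} (hs : 2 ≤ s) :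
    Summable fun i : ℕ => 1 / (2 * (i : ℝ) + 1) ^ s :=
  summable_div_odd_pow (C := 1) hs fun l => by
    rw [abs_one, one_mul]
    exact Real.one_le_sqrt.2 (by linarith [(Nat.cast_nonneg l : (0 : ℝ) ≤ l)])

/-- The difference of the truncated sums of `1/n` and `1/(k+n)` over odd `n`, where `k = 2l+1`. -/
lemma sum_range_odd_sub (l N : ℕ) :
    ∑ i ∈ range N, (1 / (2 * (i : ℝ) + 1) - 1 / ((2 * (l : ℝ) + 1) + (2 * (i : ℝ) + 1))) =
      (alpha 0 - alpha (2 * N)) + (harm l - ∑ i ∈ range l, 1 / ((N : ℝ) + i + 1)) / 2 := by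
  have h1 : ∀ N : ℕ, ∑ i ∈ range N, (1 / (2 * (i : ℝ) + 1) - 1 / (2 * (i : ℝ) + 2)) =
      alpha 0 - alpha (2 * N) := fun N => by
    induction N with
    | zero => simp
    | succ N ih =>
      have ha := alpha_add_alpha_succ (2 * N)
      have hb := alpha_add_alpha_succ (2 * N + 1)
      push_cast at ha hb
      rw [sum_range_succ, ih, ha.symm, show 2 * (N : ℝ) + 2 = 2 * (N : ℝ) + 1 + 1 by ring, ← hb,
        show 2 * (N + 1) = 2 * N + 1 + 1 by ring]
      ring
  have h2 : ∀ N : ℕ, ∑ i ∈ range N, (1 / ((i : ℝ) + 1) - 1 / ((l : ℝ) + i + 1)) =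
      harm l - ∑ i ∈ range l, 1 / ((N : ℝ) + i + 1) := fun N => by
    have ha : ∑ i ∈ range (l + N), 1 / ((i : ℝ) + 1) =
        harm l + ∑ i ∈ range N, 1 / ((l : ℝ) + i + 1) := by
      rw [sum_range_add]
      push_cast
      rfl
    have hb : ∑ i ∈ range (l + N), 1 / ((i : ℝ) + 1) =
        harm N + ∑ i ∈ range l, 1 / ((N : ℝ) + i + 1) := by
      rw [add_comm, sum_range_add]
      push_cast
      rfl
    rw [sum_sub_distrib, ← harm]
    linarith
  rw [← h1, ← h2, sum_div, ← sum_add_distrib]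
  refine sum_congr rfl fun i _ => ?_
  have : (0 : ℝ) < (l : ℝ) + i + 1 := by positivity
  rw [show (2 * (l : ℝ) + 1) + (2 * (i : ℝ) + 1) = 2 * ((l : ℝ) + i + 1) by ring,
    show 2 * (i : ℝ) + 2 = 2 * ((i : ℝ) + 1) by ring]
  field_simp
  ring

lemma abs_sum_range_odd_sub_le (l N : ℕ) :
    |∑ i ∈ range N, (1 / (2 * (i : ℝ) + 1) - 1 / ((2 * (l : ℝ) + 1) + (2 * (i : ℝ) + 1)))| ≤
      1 + harm l := by
  rw [abs_of_nonneg, sum_range_odd_sub]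
  · have h1 := alpha_nonneg (2 * N)
    have h2 := alpha_le 0
    have h3 : 0 ≤ ∑ i ∈ range l, 1 / ((N : ℝ) + i + 1) := sum_nonneg fun i _ => by positivity
    have h4 := harm_nonneg l
    norm_num at h2
    linarith
  · refine sum_nonneg fun i _ => sub_nonneg.2 ?_
    exact one_div_le_one_div_of_le (by positivity) (by linarith [(Nat.cast_nonneg l : (0 : ℝ) ≤ l)])

lemma tendsto_sum_range_odd_sub (l : ℕ) :
    Tendsto (fun N => ∑ i ∈ range N, (1 / (2 * (i : ℝ) + 1) -
      1 / ((2 * (l : ℝ) + 1) + (2 * (i : ℝ) + 1)))) atTop (𝓝 (alpha 0 + harm l / 2)) := by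
  simp_rw [sum_range_odd_sub]
  have h1 : Tendsto (fun N => alpha (2 * N)) atTop (𝓝 0) :=
    tendsto_alpha_zero.comp (tendsto_id.const_mul_atTop' (by norm_num))
  have h2 : Tendsto (fun N : ℕ => ∑ i ∈ range l, 1 / ((N : ℝ) + i + 1)) atTop (𝓝 0) := by
    rw [← sum_const_zero (s := range l)]
    refine tendsto_finsetSum _ fun i _ => ?_
    have := (tendsto_atTop_add_const_right atTop ((i : ℝ) + 1)
      (tendsto_natCast_atTop_atTop (R := ℝ))).inv_tendsto_atTop
    refine this.congr fun N => ?_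
    simp [add_assoc]
  simpa using (h1.const_sub (alpha 0)).add ((h2.const_sub (harm l)).div_const 2)

/-- The analogue of `sum_antidiagonal_betaSum_mul_betaSum` for products with sums of `1 / n^(p+1)`
over odd `n`. As only `p ≥ 1` occurs, one of the two partial fractions carries the factor
`1/n - 1/(k+n)`, whose sum over `n` converges. -/
lemma sum_antidiagonal_betaSum_mul_oddZeta (b N : ℕ) :
    ∑ q ∈ antidiagonal b, (-1) ^ (q.1 + 1) * betaSum (q.2 + 1) N *
        (∑ i ∈ range N, 1 / (2 * (i : ℝ) + 1) ^ (q.1 + 2)) =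
      (-1) ^ (b + 1) / 2 * (∑ l ∈ range N, (1 / (2 * (l : ℝ) + 1) ^ (b + 2) *
        ∑ i ∈ range N, (-1 : ℝ) ^ i / ((l : ℝ) + i + 1))) -
      ∑ l ∈ range N, ((-1) ^ l / (2 * (l : ℝ) + 1) ^ (b + 2) *
        ∑ i ∈ range N, (1 / (2 * (i : ℝ) + 1) - 1 / ((2 * (l : ℝ) + 1) + (2 * (i : ℝ) + 1)))) := by
  have key : ∑ q ∈ antidiagonal b, (-1) ^ (q.1 + 1) * betaSum (q.2 + 1) N *
        (∑ i ∈ range N, 1 / (2 * (i : ℝ) + 1) ^ (q.1 + 2)) =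
      ∑ l ∈ range N, ∑ i ∈ range N, ((-1 : ℝ) ^ l * (-1 / (2 * (i : ℝ) + 1)) *
        ∑ q ∈ antidiagonal b, (-1) ^ q.1 * (1 / (2 * (l : ℝ) + 1) ^ (q.2 + 1)) *
          (1 / (2 * (i : ℝ) + 1) ^ (q.1 + 1))) := by
    conv_rhs =>
      simp only [mul_sum]
      rw [sum_congr rfl fun l _ => sum_comm, sum_comm]
    refine sum_congr rfl fun q _ => ?_
    rw [mul_assoc, betaSum, sum_mul_sum, mul_sum]
    refine sum_congr rfl fun l _ => ?_
    rw [mul_sum]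
    refine sum_congr rfl fun i _ => ?_
    field_simp
    ring
  have hS : (-1) ^ (b + 1) / 2 * (∑ l ∈ range N, (1 / (2 * (l : ℝ) + 1) ^ (b + 2) *
        ∑ i ∈ range N, (-1 : ℝ) ^ i / ((l : ℝ) + i + 1))) =
      ∑ l ∈ range N, ∑ i ∈ range N, (-1) ^ (b + 1) * (1 / (2 * (i : ℝ) + 1) ^ (b + 2) *
        ((-1 : ℝ) ^ l / ((2 * (l : ℝ) + 1) + (2 * (i : ℝ) + 1)))) := by
    rw [mul_sum, sum_comm]
    refine sum_congr rfl fun l _ => ?_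
    rw [← mul_sum, ← mul_sum]
    have e : ∑ i ∈ range N, (-1 : ℝ) ^ i / ((2 * (i : ℝ) + 1) + (2 * (l : ℝ) + 1)) =
        ∑ i ∈ range N, (-1 : ℝ) ^ i / ((2 * (l : ℝ) + 1) + (2 * (i : ℝ) + 1)) :=
      sum_congr rfl fun i _ => by rw [add_comm (2 * (i : ℝ) + 1)]
    rw [e, sum_range_alternating_half_eq]
    ring
  rw [key, hS, ← sum_sub_distrib]
  refine sum_congr rfl fun l _ => ?_
  rw [mul_sum, ← sum_sub_distrib]
  refine sum_congr rfl fun i _ => ?_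
  rw [sum_antidiagonal_partial_fractions (by positivity) (by positivity)]
  field_simp
  ring

lemma abs_one_add_harm_le (l : ℕ) : |1 + harm l| ≤ 3 * √((l : ℝ) + 1) := by
  have h0 : (0 : ℝ) ≤ l := Nat.cast_nonneg l
  rw [abs_of_nonneg (by linarith [harm_nonneg l])]
  have h1 := harm_le_two_mul_sqrt l
  have h2 : √(l : ℝ) ≤ √((l : ℝ) + 1) := Real.sqrt_le_sqrt (by linarith)
  have h3 : 1 ≤ √((l : ℝ) + 1) := Real.one_le_sqrt.2 (by linarith)
  linarith

/-- The products of `β(r+1)` with `∑ 1/n^(p+1)` over odd `n`, summed over `p + r = m = b + 1` with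
`p ≥ 1`, as single series. -/
theorem sum_antidiagonal_beta_mul_oddZeta (b : ℕ) :
    ∑ q ∈ antidiagonal b, (-1) ^ (q.1 + 1) * dirichletBeta (q.2 + 1) * oddZeta (q.1 + 2) =
      (-1) ^ (b + 1) / 2 * (∑' l : ℕ, 1 / (2 * (l : ℝ) + 1) ^ (b + 2) * alpha l) -
      ∑' l : ℕ, (-1) ^ l / (2 * (l : ℝ) + 1) ^ (b + 2) * (alpha 0 + harm l / 2) := by
  refine tendsto_nhds_unique (tendsto_finsetSum _ fun q _ =>
    ((tendsto_betaSum (q.2 + 1) (by omega)).const_mul _).mul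
      (summable_oddZeta (s := q.1 + 2) (by omega)).hasSum.tendsto_sum_nat) ?_
  simp_rw [sum_antidiagonal_betaSum_mul_oddZeta]
  refine ((tendsto_sum_range_mul_of_dominated (C := fun l => 2 / ((l : ℝ) + 1)) ?_
    (fun N l => abs_sum_range_alternating_le l N) tendsto_sum_range_alternating).const_mul _).sub
    (tendsto_sum_range_mul_of_dominated (C := fun l => 1 + harm l) ?_
      (fun N l => abs_sum_range_odd_sub_le l N) tendsto_sum_range_odd_sub)
  · refine (summable_norm_div_odd_pow_mul_two_div (b + 1)).congr fun l => ?_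
    rw [norm_div, norm_div, norm_pow, norm_neg, norm_one, one_pow]
  · refine (summable_div_odd_pow (s := b + 2) (by omega) abs_one_add_harm_le).congr fun l => ?_
    rw [norm_div, norm_pow, norm_neg, norm_one, one_pow, Real.norm_of_nonneg (by positivity)]
    ring

/-! ### Moments of odd cosines -/

lemma lintegral_Ioo_ofReal {a b : ℝ} (hab : a ≤ b) {f : ℝ → ℝ} (hf : ContinuousOn f (Set.Icc a b))
    (h0 : ∀ x ∈ Set.Icc a b, 0 ≤ f x) :
    ∫⁻ x in Set.Ioo a b, ENNReal.ofReal (f x) = ENNReal.ofReal (∫ x in a..b, f x) := by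
  rw [intervalIntegral.integral_of_le hab, integral_Ioc_eq_integral_Ioo,
    ofReal_integral_eq_lintegral_ofReal]
  · exact (hf.integrableOn_Icc).mono_set Set.Ioo_subset_Icc_self
  · exact (ae_restrict_mem measurableSet_Ioo).mono fun x hx => h0 x (Set.Ioo_subset_Icc_self hx)

/-- The moment `∫₀^{π/2} c^m cos((2l+1)c) dc`. -/
noncomputable def cosMoment (m l : ℕ) : ℝ :=
  ∫ c in (0 : ℝ)..(Real.pi / 2), c ^ m * Real.cos ((2 * (l : ℝ) + 1) * c)

lemma integral_pow_mul_cexp (m : ℕ) {w : ℂ} (hw : w ≠ 0) (T : ℝ) :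
    ∫ c in (0 : ℝ)..T, (Complex.I * c) ^ m / (m.factorial : ℂ) * Complex.exp (w * c) =
      ∑ q ∈ antidiagonal m, (Complex.I * T) ^ q.1 / (q.1.factorial : ℂ) * Complex.exp (w * T) *
        ((-Complex.I) ^ q.2 / w ^ (q.2 + 1)) - (-Complex.I) ^ m / w ^ (m + 1) := by
  have hE : ∀ x : ℝ, HasDerivAt (fun c : ℝ => Complex.exp (w * c) / w) (Complex.exp (w * x)) x := by
    intro x
    have h := (((hasDerivAt_id (x : ℂ)).const_mul w).cexp.div_const w).comp_ofReal
    simp only [id_eq, mul_one] at h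
    refine h.congr_deriv ?_
    field_simp
  induction m with
  | zero =>
    have h := intervalIntegral.integral_eq_sub_of_hasDerivAt (a := 0) (b := T) (fun x _ => hE x)
      (Continuous.intervalIntegrable (by fun_prop) _ _)
    simp only [pow_zero, Nat.factorial_zero, Nat.cast_one, div_one, one_mul, h]
    simp [div_eq_mul_inv]
  | succ m ih =>
    have hu : ∀ x : ℝ, HasDerivAt (fun c : ℝ => (Complex.I * c) ^ (m + 1) / ((m + 1).factorial : ℂ))
        (Complex.I * ((Complex.I * x) ^ m / (m.factorial : ℂ))) x := by
      intro x
      have h := ((((hasDerivAt_id (x : ℂ)).const_mul Complex.I).pow (m + 1)).div_const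
        ((m + 1).factorial : ℂ)).comp_ofReal
      refine h.congr_deriv ?_
      have h1 : (m.factorial : ℂ) ≠ 0 := by exact_mod_cast m.factorial_ne_zero
      have h2 : (m : ℂ) + 1 ≠ 0 := by exact_mod_cast m.succ_ne_zero
      simp only [id_eq, Nat.factorial_succ]
      push_cast
      field_simp
    rw [intervalIntegral.integral_mul_deriv_eq_deriv_mul (fun x _ => hu x) (fun x _ => hE x)
      (Continuous.intervalIntegrable (by fun_prop) _ _)
      (Continuous.intervalIntegrable (by fun_prop) _ _)]
    have e : ∀ x : ℝ, Complex.I * ((Complex.I * x) ^ m / (m.factorial : ℂ)) *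
        (Complex.exp (w * x) / w) = (Complex.I / w) *
          ((Complex.I * x) ^ m / (m.factorial : ℂ) * Complex.exp (w * x)) := fun x => by ring
    simp_rw [e]
    rw [intervalIntegral.integral_const_mul, ih, Nat.sum_antidiagonal_succ']
    have e2 : ∀ q ∈ antidiagonal m, (Complex.I * T) ^ q.1 / (q.1.factorial : ℂ) *
        Complex.exp (w * T) * ((-Complex.I) ^ (q.2 + 1) / w ^ (q.2 + 1 + 1)) =
        -(Complex.I / w) * ((Complex.I * T) ^ q.1 / (q.1.factorial : ℂ) * Complex.exp (w * T) *
        ((-Complex.I) ^ q.2 / w ^ (q.2 + 1))) := fun q _ => by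
      rw [pow_succ w (q.2 + 1), pow_succ (-Complex.I)]
      field_simp
    rw [sum_congr rfl e2, ← mul_sum]
    simp only [Complex.ofReal_zero, mul_zero]
    rw [zero_pow (by omega), pow_succ (-Complex.I), pow_succ w (m + 1)]
    field_simp
    ring

lemma cexp_odd_mul_half_pi (l : ℕ) :
    Complex.exp ((2 * (l : ℂ) + 1) * Complex.I * (Real.pi / 2 : ℝ)) = (-1) ^ l * Complex.I := by
  have : (2 * (l : ℂ) + 1) * Complex.I * (Real.pi / 2 : ℝ) =
      l * (Real.pi * Complex.I) + Real.pi / 2 * Complex.I := by push_cast; ring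
  rw [this, Complex.exp_add, Complex.exp_nat_mul, Complex.exp_pi_mul_I,
    Complex.exp_pi_div_two_mul_I]

/-- The moments of the odd cosines: both exponentials contribute `(-1)^l` at `π/2`. -/
lemma I_pow_mul_cosMoment (m l : ℕ) :
    Complex.I ^ m * (cosMoment m l : ℂ) / (m.factorial : ℂ) =
      (-1) ^ l / 2 * ∑ q ∈ antidiagonal m, (Complex.I * Real.pi / 2) ^ q.1 / (q.1.factorial : ℂ) *
        ((1 + (-1) ^ q.2) / (2 * (l : ℂ) + 1) ^ (q.2 + 1)) -
      Complex.I / 2 * (1 - (-1) ^ m) / (2 * (l : ℂ) + 1) ^ (m + 1) := by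
  have hk : (2 * (l : ℂ) + 1) ≠ 0 := by exact_mod_cast (by positivity : (2 * (l : ℝ) + 1) ≠ 0)
  set k : ℂ := 2 * (l : ℂ) + 1 with hkdef
  have h1 := integral_pow_mul_cexp m (mul_ne_zero hk Complex.I_ne_zero) (Real.pi / 2)
  have h2 := integral_pow_mul_cexp m (neg_ne_zero.2 (mul_ne_zero hk Complex.I_ne_zero))
    (Real.pi / 2)
  have e1 := cexp_odd_mul_half_pi l
  rw [← hkdef] at e1
  have e2 : Complex.exp (-(k * Complex.I) * (Real.pi / 2 : ℝ)) = -((-1) ^ l * Complex.I) := by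
    rw [neg_mul, Complex.exp_neg, e1, mul_inv, Complex.inv_I, ← inv_pow]
    norm_num
  have hM : Complex.I ^ m * (cosMoment m l : ℂ) / (m.factorial : ℂ) =
      (∫ c in (0 : ℝ)..(Real.pi / 2), (Complex.I * c) ^ m / (m.factorial : ℂ) *
        Complex.exp (k * Complex.I * c)) / 2 +
      (∫ c in (0 : ℝ)..(Real.pi / 2), (Complex.I * c) ^ m / (m.factorial : ℂ) *
        Complex.exp (-(k * Complex.I) * c)) / 2 := by
    rw [← add_div, ← intervalIntegral.integral_add
      (Continuous.intervalIntegrable (by fun_prop) _ _)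
      (Continuous.intervalIntegrable (by fun_prop) _ _), cosMoment,
      ← intervalIntegral.integral_ofReal, mul_div_right_comm,
      ← intervalIntegral.integral_const_mul, ← intervalIntegral.integral_div]
    congr 1
    ext c
    push_cast
    rw [Complex.cos, mul_pow, hkdef]
    have a1 : (2 * (l : ℂ) + 1) * c * Complex.I = (2 * (l : ℂ) + 1) * Complex.I * c := by ring
    have a2 : -((2 * (l : ℂ) + 1) * c) * Complex.I = -((2 * (l : ℂ) + 1) * Complex.I) * c := by ring
    rw [a1, a2]
    ring
  rw [hM, h1, h2, e1, e2]
  have hI := Complex.I_ne_zero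
  have t1 : ∀ b : ℕ, (-Complex.I) ^ b / (k * Complex.I) ^ (b + 1) =
      -Complex.I * (-1) ^ b / k ^ (b + 1) := fun b => by
    rw [neg_pow, mul_pow, pow_succ Complex.I]
    field_simp
    rw [Complex.I_sq]
    ring
  have t2 : ∀ b : ℕ, (-Complex.I) ^ b / (-(k * Complex.I)) ^ (b + 1) =
      Complex.I / k ^ (b + 1) := fun b => by
    rw [← mul_neg, mul_pow, pow_succ (-Complex.I)]
    have : (-Complex.I) ≠ 0 := neg_ne_zero.2 hI
    field_simp
    rw [Complex.I_sq]
  simp_rw [t1, t2]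
  have hs : (-1) ^ l / 2 * ∑ q ∈ antidiagonal m, (Complex.I * Real.pi / 2) ^ q.1 /
        (q.1.factorial : ℂ) * ((1 + (-1) ^ q.2) / k ^ (q.2 + 1)) =
      (∑ q ∈ antidiagonal m, (Complex.I * (Real.pi / 2 : ℝ)) ^ q.1 / (q.1.factorial : ℂ) *
        ((-1) ^ l * Complex.I) * (-Complex.I * (-1) ^ q.2 / k ^ (q.2 + 1))) / 2 +
      (∑ q ∈ antidiagonal m, (Complex.I * (Real.pi / 2 : ℝ)) ^ q.1 / (q.1.factorial : ℂ) *
        (-((-1) ^ l * Complex.I)) * (Complex.I / k ^ (q.2 + 1))) / 2 := by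
    rw [mul_sum, ← add_div, ← sum_add_distrib, sum_div]
    refine sum_congr rfl fun q _ => ?_
    push_cast
    linear_combination (-((Complex.I * Real.pi / 2) ^ q.1 / (q.1.factorial : ℂ)) * (-1) ^ l / 2 *
      ((1 + (-1) ^ q.2) / k ^ (q.2 + 1))) * (-Complex.I_sq)
  rw [hs]
  ring

lemma exists_cosMoment_le (m : ℕ) : ∃ C : ℝ, 0 ≤ C ∧ ∀ l, |cosMoment m l| ≤ C / ((l : ℝ) + 1) := by
  refine ⟨m.factorial * ((∑ q ∈ antidiagonal m, (Real.pi / 2) ^ q.1 / (q.1.factorial : ℝ)) + 1),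
    by positivity, fun l => ?_⟩
  have h0 : (0 : ℝ) ≤ l := Nat.cast_nonneg l
  have h := congrArg norm (I_pow_mul_cosMoment m l)
  have hkn : ∀ b : ℕ, ‖(2 * (l : ℂ) + 1) ^ (b + 1)‖ = (2 * (l : ℝ) + 1) ^ (b + 1) := fun b => by
    rw [norm_pow]
    congr 1
    exact_mod_cast Complex.norm_of_nonneg (r := 2 * (l : ℝ) + 1) (by positivity)
  have hkb : ∀ b : ℕ, 1 / (2 * (l : ℝ) + 1) ^ (b + 1) ≤ 1 / ((l : ℝ) + 1) := fun b => by
    gcongr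
    calc (l : ℝ) + 1 ≤ 2 * (l : ℝ) + 1 := by linarith
      _ = (2 * (l : ℝ) + 1) ^ 1 := (pow_one _).symm
      _ ≤ _ := pow_le_pow_right₀ (by linarith) (by omega)
  have hsg : ∀ b : ℕ, ‖(1 : ℂ) + (-1) ^ b‖ ≤ 2 := fun b => by
    refine (norm_add_le _ _).trans ?_
    simp
    norm_num
  have hsg' : ‖(1 : ℂ) - (-1) ^ m‖ ≤ 2 := by
    refine (norm_sub_le _ _).trans ?_
    simp
    norm_num
  rw [norm_div, norm_mul, norm_pow, Complex.norm_I, one_pow, one_mul, Complex.norm_real,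
    Complex.norm_natCast, Real.norm_eq_abs, div_eq_iff (by positivity)] at h
  rw [h, mul_comm, mul_div_assoc (m.factorial : ℝ)]
  refine mul_le_mul_of_nonneg_left ?_ (by positivity)
  refine (norm_sub_le _ _).trans ?_
  rw [add_div]
  refine add_le_add ?_ ?_
  · rw [norm_mul, norm_div, norm_pow, norm_neg, norm_one, one_pow, Complex.norm_ofNat]
    suffices hsum : ‖∑ q ∈ antidiagonal m, (Complex.I * Real.pi / 2) ^ q.1 / (q.1.factorial : ℂ) *
        ((1 + (-1) ^ q.2) / (2 * (l : ℂ) + 1) ^ (q.2 + 1))‖ ≤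
        (∑ q ∈ antidiagonal m, (Real.pi / 2) ^ q.1 / (q.1.factorial : ℝ)) *
          (2 * (1 / ((l : ℝ) + 1))) by
      calc _ ≤ _ := mul_le_mul_of_nonneg_left hsum (by norm_num)
        _ = _ := by ring
    rw [sum_mul]
    refine (norm_sum_le _ _).trans (sum_le_sum fun q _ => ?_)
    rw [norm_mul, norm_div, norm_div, norm_pow, hkn, norm_div, norm_mul, Complex.norm_I,
      Complex.norm_real, Complex.norm_natCast, Complex.norm_ofNat, one_mul,
      Real.norm_of_nonneg Real.pi_pos.le]
    have := mul_le_mul (hsg q.2) (hkb q.2) (by positivity) (by norm_num)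
    refine mul_le_mul_of_nonneg_left ?_ (by positivity)
    rw [div_eq_mul_one_div]
    exact this
  · rw [norm_div, hkn, norm_mul, norm_div, Complex.norm_I, Complex.norm_ofNat]
    calc 1 / 2 * ‖(1 : ℂ) - (-1) ^ m‖ / (2 * (l : ℝ) + 1) ^ (m + 1)
        ≤ 1 / 2 * 2 / (2 * (l : ℝ) + 1) ^ (m + 1) := by gcongr
      _ ≤ 1 / ((l : ℝ) + 1) := by norm_num; simpa using hkb m

/-! ### The function `-2 log (sin c) / cos c` -/

/-- The function `-2 log (sin c) / cos c`. -/
noncomputable def logSinDivCos (c : ℝ) : ℝ := -2 * Real.log (Real.sin c) / Real.cos c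

lemma sin_pos_of_mem {c : ℝ} (hc : c ∈ Set.Ioo 0 (Real.pi / 2)) : 0 < Real.sin c :=
  Real.sin_pos_of_pos_of_lt_pi hc.1 (by linarith [hc.2, Real.pi_pos])

lemma cos_pos_of_mem {c : ℝ} (hc : c ∈ Set.Ioo 0 (Real.pi / 2)) : 0 < Real.cos c :=
  Real.cos_pos_of_mem_Ioo ⟨by linarith [hc.1, Real.pi_pos], hc.2⟩

/-- The `a`-integral of the kernel `1 / (cos a sin b)` along a line `b - a = c`. -/
lemma integral_one_div_cos_mul_sin {c : ℝ} (hc : c ∈ Set.Ioo 0 (Real.pi / 2)) :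
    ∫ a in (0 : ℝ)..(Real.pi / 2 - c), 1 / (Real.cos a * Real.sin (a + c)) = logSinDivCos c := by
  have hcc := cos_pos_of_mem hc
  have hle : 0 ≤ Real.pi / 2 - c := by linarith [hc.2]
  have hpos : ∀ a ∈ Set.uIcc 0 (Real.pi / 2 - c), 0 < Real.cos a ∧ 0 < Real.sin (a + c) := by
    intro a ha
    rw [Set.uIcc_of_le hle] at ha
    exact ⟨Real.cos_pos_of_mem_Ioo ⟨by linarith [ha.1, Real.pi_pos], by linarith [ha.2, hc.1]⟩,
      Real.sin_pos_of_pos_of_lt_pi (by linarith [ha.1, hc.1]) (by linarith [ha.2, Real.pi_pos])⟩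
  have hd : ∀ a ∈ Set.uIcc 0 (Real.pi / 2 - c), HasDerivAt
      (fun a => (Real.log (Real.sin (a + c)) - Real.log (Real.cos a)) / Real.cos c)
      (1 / (Real.cos a * Real.sin (a + c))) a := by
    intro a ha
    obtain ⟨h1, h2⟩ := hpos a ha
    have := (((Real.hasDerivAt_sin (a + c)).comp_add_const a c |>.log h2.ne').sub
      ((Real.hasDerivAt_cos a).log h1.ne')).div_const (Real.cos c)
    refine this.congr_deriv ?_
    have e : Real.cos c = Real.cos (a + c) * Real.cos a + Real.sin (a + c) * Real.sin a := by
      rw [← Real.cos_sub]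
      ring_nf
    field_simp
    rw [e]
    ring
  rw [intervalIntegral.integral_eq_sub_of_hasDerivAt hd, logSinDivCos]
  · simp only [sub_add_cancel, Real.sin_pi_div_two, Real.log_one, Real.cos_pi_div_two_sub, zero_add,
      Real.cos_zero]
    ring
  · refine ContinuousOn.intervalIntegrable (ContinuousOn.div (by fun_prop) (by fun_prop) ?_)
    exact fun a ha => (mul_pos (hpos a ha).1 (hpos a ha).2).ne'

/-- A Poisson-type kernel on `(0, 1) × (0, π/2)`: the factor depending on `c` is
`∑ x^l cos((2l+1)c)`, see `hasSum_poisson`. -/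
noncomputable def poissonKer (x c : ℝ) : ℝ :=
  4 / (1 + x) * ((1 - x) * Real.cos c / (1 - 2 * x * Real.cos (2 * c) + x ^ 2))

lemma poisson_denom_pos {x c : ℝ} (h : Real.sin (2 * c) ≠ 0 ∨ x ∈ Set.Ioo (0 : ℝ) 1) :
    0 < 1 - 2 * x * Real.cos (2 * c) + x ^ 2 := by
  have h1 := Real.sin_sq_add_cos_sq (2 * c)
  rcases h with h | h
  · have := pow_pos (abs_pos.2 h) 2
    rw [sq_abs] at this
    nlinarith [sq_nonneg (x - Real.cos (2 * c))]
  · have := Real.cos_le_one (2 * c)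
    nlinarith [h.1, h.2, mul_pos (sub_pos.2 h.2) (sub_pos.2 h.2),
      mul_nonneg h.1.le (sub_nonneg.2 this)]

lemma sin_two_mul_ne_zero_of_mem {c : ℝ} (hc : c ∈ Set.Ioo 0 (Real.pi / 2)) :
    Real.sin (2 * c) ≠ 0 :=
  (Real.sin_pos_of_pos_of_lt_pi (by linarith [hc.1]) (by linarith [hc.2])).ne'

lemma continuousOn_poissonKer_left {c : ℝ} (hc : c ∈ Set.Ioo 0 (Real.pi / 2)) :
    ContinuousOn (fun x => poissonKer x c) (Set.Icc 0 1) := by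
  refine (ContinuousOn.div (by fun_prop) (by fun_prop) fun x hx => ?_).mul
    (ContinuousOn.div (by fun_prop) (by fun_prop) fun x hx => ?_)
  · linarith [hx.1]
  · exact (poisson_denom_pos (Or.inl (sin_two_mul_ne_zero_of_mem hc))).ne'

/-- Integrating the Poisson-type kernel over `x` gives the same function of `c`. -/
lemma integral_poissonKer {c : ℝ} (hc : c ∈ Set.Ioo 0 (Real.pi / 2)) :
    ∫ x in (0 : ℝ)..1, poissonKer x c = logSinDivCos c := by
  have hcc := cos_pos_of_mem hc
  have hsc := sin_pos_of_mem hc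
  have hden : ∀ x, 0 < 1 - 2 * x * Real.cos (2 * c) + x ^ 2 := fun x =>
    poisson_denom_pos (Or.inl (sin_two_mul_ne_zero_of_mem hc))
  have hd : ∀ x ∈ Set.uIcc (0 : ℝ) 1, HasDerivAt
      (fun x => (2 * Real.log (1 + x) - Real.log (1 - 2 * x * Real.cos (2 * c) + x ^ 2)) /
        Real.cos c) (poissonKer x c) x := by
    intro x hx
    rw [Set.uIcc_of_le zero_le_one] at hx
    have h1 : 1 + x ≠ 0 := by linarith [hx.1]
    have hq : HasDerivAt (fun x : ℝ => 1 - 2 * x * Real.cos (2 * c) + x ^ 2)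
        (-(2 * Real.cos (2 * c)) + 2 * x) x := by
      have := ((((hasDerivAt_id x).const_mul 2).mul_const (Real.cos (2 * c))).const_sub 1).add
        ((hasDerivAt_id x).pow 2)
      refine this.congr_deriv ?_
      simp
    have := (((((hasDerivAt_id x).const_add 1).log h1).const_mul 2).sub
      (hq.log (hden x).ne')).div_const (Real.cos c)
    refine this.congr_deriv ?_
    have hx0 := (hden x).ne'
    rw [poissonKer]
    simp only [id_eq]
    field_simp
    rw [Real.cos_two_mul]
    ring
  rw [intervalIntegral.integral_eq_sub_of_hasDerivAt hd, logSinDivCos]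
  · have e : 1 - 2 * 1 * Real.cos (2 * c) + 1 ^ 2 = (2 * Real.sin c) ^ 2 := by
      rw [Real.cos_two_mul, mul_pow, Real.sin_sq]
      ring
    rw [e, Real.log_pow, Real.log_mul two_ne_zero hsc.ne']
    norm_num
    ring
  · refine ContinuousOn.intervalIntegrable ?_
    rw [Set.uIcc_of_le zero_le_one]
    exact continuousOn_poissonKer_left hc

lemma poissonKer_nonneg {x c : ℝ} (hx : x ∈ Set.Icc (0 : ℝ) 1)
    (hc : c ∈ Set.Icc 0 (Real.pi / 2)) : 0 ≤ poissonKer x c := by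
  have h1 : 0 ≤ 1 - 2 * x * Real.cos (2 * c) + x ^ 2 := by
    have := Real.cos_le_one (2 * c)
    nlinarith [hx.1, sq_nonneg (1 - x), mul_nonneg hx.1 (sub_nonneg.2 this)]
  have h2 := Real.cos_nonneg_of_mem_Icc (x := c) ⟨by linarith [hc.1, Real.pi_pos], hc.2⟩
  have h3 := hx.1
  have h4 : 0 ≤ 1 - x := by linarith [hx.2]
  rw [poissonKer]
  positivity

/-- With `u = k + i s` on the unit circle, this is `u / (1 - X u²)` split into the real and
imaginary parts that it has for real `X`, `k` and `s`. -/
lemma poisson_identity {X s k D : ℂ} (hs : s ^ 2 + k ^ 2 = 1)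
    (hD : D = 1 - 2 * X * (2 * k ^ 2 - 1) + X ^ 2) (hD0 : D ≠ 0) :
    k + s * Complex.I = ((1 - X) * k / D + (1 + X) * s / D * Complex.I) *
      (1 - X * (k + s * Complex.I) ^ 2) := by
  have hs2 : s ^ 2 = 1 - k ^ 2 := by rw [← hs]; ring
  have hs3 : s ^ 3 = s * (1 - k ^ 2) := by rw [pow_succ, hs2]; ring
  have hI3 : Complex.I ^ 3 = -Complex.I := by rw [pow_succ, Complex.I_sq]; ring
  field_simp
  rw [hD]
  ring_nf
  simp only [Complex.I_sq, hI3, hs3, hs2]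
  ring

lemma hasSum_poisson {x : ℝ} (hx : x ∈ Set.Ioo (0 : ℝ) 1) (c : ℝ) :
    HasSum (fun l : ℕ => x ^ l * Real.cos ((2 * (l : ℝ) + 1) * c))
      ((1 - x) * Real.cos c / (1 - 2 * x * Real.cos (2 * c) + x ^ 2)) := by
  set u : ℂ := Complex.exp (c * Complex.I) with hu
  have hnu : ‖u‖ = 1 := Complex.norm_exp_ofReal_mul_I c
  have hn : ‖(x : ℂ) * u ^ 2‖ < 1 := by
    rw [norm_mul, norm_pow, hnu, Complex.norm_real, Real.norm_of_nonneg hx.1.le]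
    simpa using hx.2
  have h := ((hasSum_geometric_of_norm_lt_one hn).mul_left u).mapL Complex.reCLM
  have e1 : ∀ l : ℕ, Complex.reCLM (u * ((x : ℂ) * u ^ 2) ^ l) =
      x ^ l * Real.cos ((2 * (l : ℝ) + 1) * c) := by
    intro l
    have : u * ((x : ℂ) * u ^ 2) ^ l = ((x ^ l : ℝ) : ℂ) *
        Complex.exp (((2 * (l : ℝ) + 1) * c : ℝ) * Complex.I) := by
      rw [mul_pow, ← pow_mul, mul_left_comm, ← pow_succ', hu, ← Complex.exp_nat_mul]
      push_cast
      ring_nf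
    rw [this, Complex.reCLM_apply, Complex.re_ofReal_mul, Complex.exp_ofReal_mul_I_re]
  have hden := poisson_denom_pos (c := c) (Or.inr hx)
  have e2 : Complex.reCLM (u * (1 - (x : ℂ) * u ^ 2)⁻¹) =
      (1 - x) * Real.cos c / (1 - 2 * x * Real.cos (2 * c) + x ^ 2) := by
    have hu2 : u = Real.cos c + Real.sin c * Complex.I := by
      rw [hu, Complex.exp_mul_I, Complex.ofReal_cos, Complex.ofReal_sin]
    have hne : (1 - (x : ℂ) * u ^ 2) ≠ 0 := by
      intro h0
      rw [sub_eq_zero] at h0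
      rw [← h0] at hn
      simp at hn
    have hsq := Real.sin_sq_add_cos_sq c
    have key : u * (1 - (x : ℂ) * u ^ 2)⁻¹ =
        (((1 - x) * Real.cos c / (1 - 2 * x * Real.cos (2 * c) + x ^ 2) : ℝ) : ℂ) +
        (((1 + x) * Real.sin c / (1 - 2 * x * Real.cos (2 * c) + x ^ 2) : ℝ) : ℂ) * Complex.I := by
      rw [← div_eq_mul_inv, div_eq_iff hne, hu2, Complex.ofReal_div, Complex.ofReal_div]
      have := poisson_identity (X := x) (s := (Real.sin c : ℂ)) (k := (Real.cos c : ℂ))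
        (D := ((1 - 2 * x * Real.cos (2 * c) + x ^ 2 : ℝ) : ℂ)) (by exact_mod_cast hsq)
        (by rw [Real.cos_two_mul]; push_cast; ring) (by exact_mod_cast hden.ne')
      push_cast at this ⊢
      exact this
    rw [key, Complex.reCLM_apply, Complex.add_re, Complex.ofReal_re, Complex.re_ofReal_mul,
      Complex.I_re, mul_zero, add_zero]
  rw [← e2]
  exact h.congr_fun fun l => (e1 l).symm

/-! ### Moments of `-2 log (sin c) / cos c` -/

lemma measurable_poissonKer : Measurable fun q : ℝ × ℝ => poissonKer q.1 q.2 := by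
  unfold poissonKer
  fun_prop

lemma integral_pow_mul_poissonKer (m : ℕ) {x : ℝ} (hx : x ∈ Set.Ioo (0 : ℝ) 1) :
    ∫ c in (0 : ℝ)..(Real.pi / 2), c ^ m * poissonKer x c =
      ∑' l : ℕ, 4 * cosMoment m l * (x ^ l / (1 + x)) := by
  have hpi : (0 : ℝ) ≤ Real.pi / 2 := by positivity
  have h := intervalIntegral.hasSum_integral_of_dominated_convergence (μ := volume) (a := 0)
    (b := Real.pi / 2)
    (F := fun (l : ℕ) (c : ℝ) => 4 / (1 + x) * (c ^ m * (x ^ l * Real.cos ((2 * (l : ℝ) + 1) * c))))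
    (f := fun c => c ^ m * poissonKer x c)
    (fun l _ => 4 / (1 + x) * ((Real.pi / 2) ^ m * x ^ l))
    (fun l => Continuous.aestronglyMeasurable (by fun_prop))
    (fun l => Eventually.of_forall fun c hc => by
      rw [Set.uIoc_of_le hpi] at hc
      have h1 : 0 ≤ 4 / (1 + x) := by have := hx.1; positivity
      rw [norm_mul, norm_mul, norm_mul, Real.norm_of_nonneg h1, norm_pow, norm_pow,
        Real.norm_of_nonneg hc.1.le, Real.norm_of_nonneg hx.1.le]
      have h2 : ‖Real.cos ((2 * (l : ℝ) + 1) * c)‖ ≤ 1 := Real.abs_cos_le_one _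
      have h3 := hc.1.le
      have h4 := hx.1.le
      calc 4 / (1 + x) * (c ^ m * (x ^ l * ‖Real.cos ((2 * (l : ℝ) + 1) * c)‖))
          ≤ 4 / (1 + x) * ((Real.pi / 2) ^ m * (x ^ l * 1)) := by
            gcongr
            exact hc.2
        _ = _ := by rw [mul_one])
    (Eventually.of_forall fun c _ =>
      ((summable_geometric_of_lt_one hx.1.le hx.2).mul_left _).mul_left _)
    (by simp)
    (Eventually.of_forall fun c _ => by
      have := ((hasSum_poisson hx c).mul_left (c ^ m)).mul_left (4 / (1 + x))
      rwa [show c ^ m * poissonKer x c = 4 / (1 + x) * (c ^ m * ((1 - x) * Real.cos c /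
        (1 - 2 * x * Real.cos (2 * c) + x ^ 2))) by rw [poissonKer]; ring])
  rw [← h.tsum_eq]
  refine tsum_congr fun l => ?_
  rw [cosMoment, intervalIntegral.integral_const_mul]
  have : ∫ c in (0 : ℝ)..(Real.pi / 2), c ^ m * (x ^ l * Real.cos ((2 * (l : ℝ) + 1) * c)) =
      x ^ l * ∫ c in (0 : ℝ)..(Real.pi / 2), c ^ m * Real.cos ((2 * (l : ℝ) + 1) * c) := by
    rw [← intervalIntegral.integral_const_mul]
    congr 1
    ext c
    ring
  rw [this]
  ring

lemma summable_alpha_mul_cosMoment (m : ℕ) : Summable fun l => alpha l * |cosMoment m l| := by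
  obtain ⟨C, hC0, hC⟩ := exists_cosMoment_le m
  have h : Summable fun l : ℕ => C * (1 / ((l : ℝ) + 1) ^ 2) := by
    simpa using ((summable_nat_add_iff 1).2
      (Real.summable_one_div_nat_pow.2 (by norm_num : 1 < 2))).mul_left C
  refine Summable.of_nonneg_of_le (fun l => mul_nonneg (alpha_nonneg l) (abs_nonneg _))
    (fun l => ?_) h
  calc alpha l * |cosMoment m l| ≤ 1 / ((l : ℝ) + 1) * (C / ((l : ℝ) + 1)) :=
        mul_le_mul (alpha_le l) (hC l) (abs_nonneg _) (by positivity)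
    _ = C * (1 / ((l : ℝ) + 1) ^ 2) := by field_simp

/-- The moments of `-2 log (sin c) / cos c`, from its expansion in odd cosines. The integrand is
nonnegative and Tonelli's theorem is used, so the value is stated for the lower integral. -/
theorem lintegral_pow_mul_logSinDivCos (m : ℕ) :
    (∫⁻ c in Set.Ioo 0 (Real.pi / 2), ENNReal.ofReal (c ^ m * logSinDivCos c)).toReal =
      4 * ∑' l, alpha l * cosMoment m l := by
  have hpi : (0 : ℝ) ≤ Real.pi / 2 := by positivity
  have h1 : ∫⁻ c in Set.Ioo 0 (Real.pi / 2), ENNReal.ofReal (c ^ m * logSinDivCos c) =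
      ∫⁻ c in Set.Ioo 0 (Real.pi / 2), ∫⁻ x in Set.Ioo (0 : ℝ) 1,
        ENNReal.ofReal (c ^ m * poissonKer x c) := by
    refine setLIntegral_congr_fun measurableSet_Ioo fun c hc => ?_
    rw [lintegral_Ioo_ofReal (f := fun x => c ^ m * poissonKer x c) zero_le_one
      (continuousOn_const.mul (continuousOn_poissonKer_left hc))
      fun x hx => mul_nonneg (pow_nonneg hc.1.le _)
        (poissonKer_nonneg hx (Set.Ioo_subset_Icc_self hc)),
      intervalIntegral.integral_const_mul, integral_poissonKer hc]
  have h2 : ∫⁻ c in Set.Ioo 0 (Real.pi / 2), ∫⁻ x in Set.Ioo (0 : ℝ) 1,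
        ENNReal.ofReal (c ^ m * poissonKer x c) =
      ∫⁻ x in Set.Ioo (0 : ℝ) 1, ∫⁻ c in Set.Ioo 0 (Real.pi / 2),
        ENNReal.ofReal (c ^ m * poissonKer x c) := by
    refine lintegral_lintegral_swap (Measurable.aemeasurable ?_)
    have := measurable_poissonKer.comp measurable_swap
    exact ((measurable_fst.pow_const m).mul this).ennreal_ofReal
  have h3 : ∫⁻ x in Set.Ioo (0 : ℝ) 1, ∫⁻ c in Set.Ioo 0 (Real.pi / 2),
        ENNReal.ofReal (c ^ m * poissonKer x c) =
      ∫⁻ x in Set.Ioo (0 : ℝ) 1,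
        ENNReal.ofReal (∫ c in (0 : ℝ)..(Real.pi / 2), c ^ m * poissonKer x c) := by
    refine setLIntegral_congr_fun measurableSet_Ioo fun x hx => ?_
    refine lintegral_Ioo_ofReal hpi ?_ fun c hc => mul_nonneg (pow_nonneg hc.1 _)
        (poissonKer_nonneg (Set.Ioo_subset_Icc_self hx) hc)
    unfold poissonKer
    refine ContinuousOn.mul (by fun_prop) (ContinuousOn.mul (by fun_prop)
      (ContinuousOn.div (by fun_prop) (by fun_prop) fun c _ => (poisson_denom_pos (Or.inr hx)).ne'))
  rw [h1, h2, h3, ← integral_eq_lintegral_of_nonneg_ae]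
  · have hsum := hasSum_integral_of_summable_integral_norm
      (μ := volume.restrict (Set.Ioo (0 : ℝ) 1))
      (F := fun (l : ℕ) (x : ℝ) => 4 * cosMoment m l * (x ^ l / (1 + x))) (fun l => by
        have := ((intervalIntegrable_pow_div_one_add l).const_mul (4 * cosMoment m l)).1
        exact this.mono_set Set.Ioo_subset_Ioc_self) (by
        refine ((summable_alpha_mul_cosMoment m).mul_left 4).congr fun l => ?_
        rw [alpha, intervalIntegral.integral_of_le zero_le_one, integral_Ioc_eq_integral_Ioo,
          mul_comm _ |cosMoment m l|, ← mul_assoc, ← integral_const_mul]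
        refine setIntegral_congr_fun measurableSet_Ioo fun x hx => ?_
        have h0 : 0 ≤ x ^ l / (1 + x) := by have := hx.1; positivity
        rw [norm_mul, norm_mul, Real.norm_of_nonneg h0, Real.norm_ofNat, Real.norm_eq_abs])
    rw [setIntegral_congr_fun measurableSet_Ioo fun x hx => integral_pow_mul_poissonKer m hx,
      ← hsum.tsum_eq, ← tsum_mul_left]
    refine tsum_congr fun l => ?_
    rw [integral_const_mul, alpha, intervalIntegral.integral_of_le zero_le_one,
      integral_Ioc_eq_integral_Ioo]
    ring
  · refine (ae_restrict_mem measurableSet_Ioo).mono fun x hx => ?_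
    exact intervalIntegral.integral_nonneg hpi fun c hc => mul_nonneg (pow_nonneg hc.1 _)
      (poissonKer_nonneg (Set.Ioo_subset_Icc_self hx) hc)
  · simp_rw [intervalIntegral.integral_of_le hpi]
    refine StronglyMeasurable.aestronglyMeasurable ?_
    refine StronglyMeasurable.integral_prod_right (f := fun x c => c ^ m * poissonKer x c) ?_
    exact ((measurable_snd.pow_const m).mul measurable_poissonKer).stronglyMeasurable

/-! ### Repeated integration and the triangle integral -/

/-- Cauchy's formula for repeated integration, for a chain of antiderivatives vanishing at `0`. -/
lemma eq_integral_of_iterated_antideriv {h : ℕ → ℝ → ℝ} {s : ℝ → ℝ} {b : ℝ}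
    (h0 : ∀ a ∈ Set.uIcc 0 b, HasDerivAt (h 0) (s a) a)
    (hs : ∀ j, ∀ a ∈ Set.uIcc 0 b, HasDerivAt (h (j + 1)) (h j a) a)
    (hz : ∀ j, h j 0 = 0) (hsc : ContinuousOn s (Set.uIcc 0 b)) (j : ℕ) :
    h j b = ∫ a in (0 : ℝ)..b, (b - a) ^ j / (j.factorial : ℝ) * s a := by
  have parts : ∀ (i : ℕ) (u v : ℝ → ℝ), (∀ a ∈ Set.uIcc 0 b, HasDerivAt u (v a) a) →
      ContinuousOn v (Set.uIcc 0 b) → u 0 = 0 →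
      ∫ a in (0 : ℝ)..b, (b - a) ^ i / (i.factorial : ℝ) * u a =
        ∫ a in (0 : ℝ)..b, (b - a) ^ (i + 1) / ((i + 1).factorial : ℝ) * v a := by
    intro i u v hu hv hu0
    have hw : ∀ a ∈ Set.uIcc 0 b, HasDerivAt
        (fun a => -((b - a) ^ (i + 1) / ((i + 1).factorial : ℝ))) ((b - a) ^ i / (i.factorial : ℝ))
        a := by
      intro a _
      have := ((((hasDerivAt_id a).const_sub b).pow (i + 1)).div_const
        ((i + 1).factorial : ℝ)).neg
      refine this.congr_deriv ?_
      simp only [id_eq, Nat.factorial_succ]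
      push_cast
      field_simp
    have := intervalIntegral.integral_mul_deriv_eq_deriv_mul hu hw
      (hv.intervalIntegrable) (Continuous.intervalIntegrable (by fun_prop) _ _)
    have e1 : ∀ a, (b - a) ^ i / (i.factorial : ℝ) * u a =
        u a * ((b - a) ^ i / (i.factorial : ℝ)) := fun a => mul_comm _ _
    simp_rw [e1]
    rw [this, hu0, sub_self, zero_pow (by omega), zero_div, neg_zero, mul_zero, zero_mul, sub_zero,
      zero_sub, ← intervalIntegral.integral_neg]
    congr 1
    ext a
    ring
  have hc : ∀ j, ContinuousOn (h j) (Set.uIcc 0 b) := fun j a ha => by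
    cases j with
    | zero => exact (h0 a ha).continuousAt.continuousWithinAt
    | succ j => exact (hs j a ha).continuousAt.continuousWithinAt
  -- each integration by parts trades one antiderivative for a power of `b - a`
  have main : ∀ k i, ∫ a in (0 : ℝ)..b, (b - a) ^ i / (i.factorial : ℝ) * h k a =
      ∫ a in (0 : ℝ)..b, (b - a) ^ (i + k + 1) / ((i + k + 1).factorial : ℝ) * s a := by
    intro k
    induction k with
    | zero => exact fun i => parts i _ _ h0 hsc (hz 0)
    | succ k ih =>
      intro i
      rw [parts i _ _ (hs k) (hc k) (hz _), ih, show i + 1 + k + 1 = i + (k + 1) + 1 by ring]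
  cases j with
  | zero =>
    have := intervalIntegral.integral_eq_sub_of_hasDerivAt h0 hsc.intervalIntegrable
    simp [this, hz]
  | succ j =>
    have := intervalIntegral.integral_eq_sub_of_hasDerivAt (hs j) (hc j).intervalIntegrable
    have h2 := main j 0
    simp only [pow_zero, Nat.factorial_zero, Nat.cast_one, div_one, one_mul, zero_add] at h2
    rw [← h2, this, hz, sub_zero]

/-- The triangle `0 < a < b < π/2` with the kernel `(b - a)^m / (m! cos a sin b)`. -/
noncomputable def triangleKer (m : ℕ) (a b : ℝ) : ENNReal :=
  {q : ℝ × ℝ | 0 < q.1 ∧ q.1 < q.2 ∧ q.2 < Real.pi / 2}.indicator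
    (fun q => ENNReal.ofReal ((q.2 - q.1) ^ m / (m.factorial : ℝ) / (Real.cos q.1 * Real.sin q.2)))
    (a, b)

lemma measurable_triangleKer (m : ℕ) : Measurable fun q : ℝ × ℝ => triangleKer m q.1 q.2 := by
  refine Measurable.indicator (by fun_prop) ?_
  exact (measurableSet_lt measurable_const measurable_fst).inter
    ((measurableSet_lt measurable_fst measurable_snd).inter
      (measurableSet_lt measurable_snd measurable_const))

lemma lintegral_triangleKer (m : ℕ) {h : ℝ → ℝ}
    (hh : ∀ b ∈ Set.Ioo 0 (Real.pi / 2), h b = ∫ a in (0 : ℝ)..b,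
      (b - a) ^ m / (m.factorial : ℝ) * (1 / Real.cos a)) :
    ∫⁻ b in Set.Ioo 0 (Real.pi / 2), ENNReal.ofReal (h b / Real.sin b) =
      ∫⁻ b, ∫⁻ a, triangleKer m a b := by
  rw [← lintegral_indicator measurableSet_Ioo]
  refine lintegral_congr fun b => ?_
  by_cases hb : b ∈ Set.Ioo 0 (Real.pi / 2)
  · rw [Set.indicator_of_mem hb]
    have hsb := sin_pos_of_mem hb
    have e : ∀ a, triangleKer m a b = (Set.Ioo 0 b).indicator (fun a => ENNReal.ofReal
        ((b - a) ^ m / (m.factorial : ℝ) * (1 / Real.cos a) / Real.sin b)) a := by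
      intro a
      by_cases ha : a ∈ Set.Ioo 0 b
      · rw [Set.indicator_of_mem ha, triangleKer, Set.indicator_of_mem
          (show (a, b) ∈ {q : ℝ × ℝ | 0 < q.1 ∧ q.1 < q.2 ∧ q.2 < Real.pi / 2} from
            ⟨ha.1, ha.2, hb.2⟩)]
        congr 1
        dsimp only
        ring
      · rw [Set.indicator_of_notMem ha, triangleKer, Set.indicator_of_notMem]
        exact fun h => ha ⟨h.1, h.2.1⟩
    have hcos : ∀ a ∈ Set.Icc 0 b, 0 < Real.cos a := fun a ha =>
      Real.cos_pos_of_mem_Ioo ⟨by linarith [ha.1, Real.pi_pos], by linarith [ha.2, hb.2]⟩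
    rw [lintegral_congr e, lintegral_indicator measurableSet_Ioo, lintegral_Ioo_ofReal hb.1.le,
      intervalIntegral.integral_div, hh b hb]
    · exact ContinuousOn.div_const (ContinuousOn.mul (by fun_prop)
        (ContinuousOn.div (by fun_prop) (by fun_prop) fun a ha => (hcos a ha).ne')) _
    · intro a ha
      have h1 := hcos a ha
      have h2 : 0 ≤ b - a := by linarith [ha.2]
      positivity
  · rw [Set.indicator_of_notMem hb]
    have z : ∀ a, triangleKer m a b = 0 := fun a =>
      Set.indicator_of_notMem (fun h => hb ⟨h.1.trans h.2.1, h.2.2⟩) _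
    simp [z]

/-- The change of variables `c = b - a` in the triangle. -/
lemma lintegral_triangleKer_eq (m : ℕ) :
    ∫⁻ b, ∫⁻ a, triangleKer m a b = ∫⁻ c in Set.Ioo 0 (Real.pi / 2),
      ENNReal.ofReal (c ^ m * logSinDivCos c / (m.factorial : ℝ)) := by
  have hm := measurable_triangleKer m
  rw [lintegral_lintegral_swap (f := fun b a => triangleKer m a b)
    (hm.comp measurable_swap).aemeasurable]
  have h1 : ∀ a, ∫⁻ b, triangleKer m a b = ∫⁻ c, triangleKer m a (a + c) := fun a =>
    (lintegral_add_left_eq_self _ a).symm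
  simp_rw [h1]
  rw [lintegral_lintegral_swap (f := fun a c => triangleKer m a (a + c)) (by
    exact (hm.comp (measurable_fst.prodMk (measurable_fst.add measurable_snd))).aemeasurable)]
  rw [← lintegral_indicator measurableSet_Ioo]
  refine lintegral_congr fun c => ?_
  by_cases hc : c ∈ Set.Ioo 0 (Real.pi / 2)
  · rw [Set.indicator_of_mem hc]
    have e : ∀ a, triangleKer m a (a + c) = (Set.Ioo 0 (Real.pi / 2 - c)).indicator (fun a =>
        ENNReal.ofReal (c ^ m / (m.factorial : ℝ) * (1 / (Real.cos a * Real.sin (a + c))))) a := by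
      intro a
      by_cases ha : a ∈ Set.Ioo 0 (Real.pi / 2 - c)
      · rw [Set.indicator_of_mem ha, triangleKer, Set.indicator_of_mem
          (show (a, a + c) ∈ {q : ℝ × ℝ | 0 < q.1 ∧ q.1 < q.2 ∧ q.2 < Real.pi / 2} from
            ⟨ha.1, by linarith [hc.1], by linarith [ha.2]⟩)]
        congr 1
        rw [mul_one_div, add_sub_cancel_left]
      · rw [Set.indicator_of_notMem ha, triangleKer, Set.indicator_of_notMem]
        exact fun h => ha ⟨h.1, by linarith [h.2.2]⟩
    have hpos : ∀ a ∈ Set.Icc 0 (Real.pi / 2 - c), 0 < Real.cos a * Real.sin (a + c) := by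
      intro a ha
      exact mul_pos
        (Real.cos_pos_of_mem_Ioo ⟨by linarith [ha.1, Real.pi_pos], by linarith [ha.2, hc.1]⟩)
        (Real.sin_pos_of_pos_of_lt_pi (by linarith [ha.1, hc.1])
          (by linarith [ha.2, Real.pi_pos]))
    have hc0 := hc.1.le
    rw [lintegral_congr e, lintegral_indicator measurableSet_Ioo,
      lintegral_Ioo_ofReal (by linarith [hc.2]), intervalIntegral.integral_const_mul,
      integral_one_div_cos_mul_sin hc]
    · congr 1
      ring
    · exact ContinuousOn.mul (by fun_prop)
        (ContinuousOn.div (by fun_prop) (by fun_prop) fun a ha => (hpos a ha).ne')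
    · intro a ha
      have h1 := hpos a ha
      positivity
  · rw [Set.indicator_of_notMem hc]
    have z : ∀ a, triangleKer m a (a + c) = 0 := by
      refine fun a => Set.indicator_of_notMem ?_ _
      rintro ⟨h1, h2, h3⟩
      dsimp only at h1 h2 h3
      exact hc ⟨by linarith, by linarith⟩
    simp [z]

/-! ### Truncated tails and their recursion -/

lemma mixedTerm_one_even (σ : ℤˣ) (s k : ℕ) :
    mixedTerm 1 σ s (2 * k) = 2 * ((σ : ℤ) : ℝ) ^ k / ((2 * k : ℕ) : ℝ) ^ s := by
  have h : (2 * ((2 * k : ℕ) : ℤ) + 1 - ((1 : ℤˣ) : ℤ)) / 4 = (k : ℤ) := by push_cast; omega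
  rw [mixedTerm, h, zpow_natCast, pow_mul]
  norm_num

lemma mixedTerm_one_odd (σ : ℤˣ) (s k : ℕ) : mixedTerm 1 σ s (2 * k + 1) = 0 := by
  rw [mixedTerm, pow_succ, pow_mul]
  norm_num

lemma mixedTerm_neg_one_even (σ : ℤˣ) (s k : ℕ) : mixedTerm (-1) σ s (2 * k) = 0 := by
  rw [mixedTerm, pow_mul]
  norm_num

lemma mixedTerm_neg_one_odd (σ : ℤˣ) (s k : ℕ) :
    mixedTerm (-1) σ s (2 * k + 1) =
      2 * ((σ : ℤ) : ℝ) ^ (k + 1) / ((2 * k + 1 : ℕ) : ℝ) ^ s := by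
  have h : (2 * ((2 * k + 1 : ℕ) : ℤ) + 1 - ((-1 : ℤˣ) : ℤ)) / 4 = ((k + 1 : ℕ) : ℤ) := by
    push_cast; omega
  rw [mixedTerm, h, zpow_natCast, pow_succ _ (2 * k), pow_mul]
  norm_num

lemma abs_mixedTerm_le (ε σ : ℤˣ) (s n : ℕ) : |mixedTerm ε σ s n| ≤ 2 / (n : ℝ) ^ s := by
  rw [mixedTerm, abs_div, abs_mul, abs_zpow, abs_of_nonneg (by positivity : (0 : ℝ) ≤ (n : ℝ) ^ s)]
  gcongr
  have h1 : |((σ : ℤ) : ℝ)| = 1 := by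
    rcases Int.units_eq_one_or σ with rfl | rfl <;> simp
  have h2 : |((ε : ℤ) : ℝ)| = 1 := by
    rcases Int.units_eq_one_or ε with rfl | rfl <;> simp
  rw [h1, one_zpow, mul_one]
  refine (abs_add_le _ _).trans ?_
  rw [abs_mul, abs_pow, h2]
  norm_num

/-- The index `({1}_j, 1̄)`. -/
def tailIndex (j : ℕ) : List (ℤˣ × ℕ) := List.replicate j (1, 1) ++ [(-1, 1)]

lemma length_tailIndex (j : ℕ) : (tailIndex j).length = j + 1 := by simp [tailIndex]

lemma altTTerms_tailIndex_succ (j : ℕ) :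
    altTTerms (tailIndex (j + 1)) = mixedTerm ((-1) ^ (j + 2)) 1 1 :: altTTerms (tailIndex j) := by
  have h : tailIndex (j + 1) = (1, 1) :: tailIndex j := by simp [tailIndex, List.replicate_succ]
  rw [h, altTTerms, length_tailIndex]

lemma altTTerms_tailIndex_zero : altTTerms (tailIndex 0) = [mixedTerm (-1) (-1) 1] := by
  simp [tailIndex, altTTerms]

lemma altTTerms_index21_succ (j : ℕ) :
    altTTerms (index21 (j + 1)) =
      mixedTerm ((-1) ^ (j + 2)) (-1) 2 :: altTTerms (tailIndex j) := by
  rw [index21, altTTerms, Nat.add_sub_cancel, ← tailIndex, length_tailIndex]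

lemma nestedSum_succ {R : Type*} [CommSemiring R] (f : ℕ → R) (fs : List (ℕ → R)) (N : ℕ) :
    nestedSum (f :: fs) (N + 1) = nestedSum (f :: fs) N + f (N + 1) * nestedSum fs N := by
  rw [nestedSum, nestedSum, sum_Icc_succ_top (by omega), Nat.add_sub_cancel]

lemma nestedSum_cons_zero {R : Type*} [CommSemiring R] (f : ℕ → R) (fs : List (ℕ → R)) :
    nestedSum (f :: fs) 0 = 0 := by
  simp [nestedSum]

lemma abs_nestedSum_le {fs : List (ℕ → ℝ)} (h : ∀ f ∈ fs, ∀ n, |f n| ≤ 2 / (n : ℝ)) (N : ℕ) :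
    |nestedSum fs N| ≤ (2 * harm N) ^ fs.length := by
  induction fs generalizing N with
  | nil => simp [nestedSum]
  | cons f fs ih =>
    have ih' := ih fun g hg => h g (List.mem_cons_of_mem _ hg)
    induction N with
    | zero => simp [nestedSum_cons_zero, harm]
    | succ N ihN =>
      have h1 := h f List.mem_cons_self (N + 1)
      have hm : harm N ≤ harm (N + 1) := harm_mono (Nat.le_succ N)
      have h0 := harm_nonneg N
      have hs : 2 * harm (N + 1) = 2 * harm N + 2 / ((N + 1 : ℕ) : ℝ) := by
        rw [harm, sum_range_succ, ← harm]
        push_cast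
        ring
      rw [nestedSum_succ, List.length_cons, pow_succ]
      calc |nestedSum (f :: fs) N + f (N + 1) * nestedSum fs N|
          ≤ |nestedSum (f :: fs) N| + |f (N + 1)| * |nestedSum fs N| := by
            rw [← abs_mul]; exact abs_add_le _ _
        _ ≤ (2 * harm N) ^ fs.length * (2 * harm N) +
            2 / ((N + 1 : ℕ) : ℝ) * (2 * harm N) ^ fs.length := by
            rw [← pow_succ]
            exact add_le_add ihN (mul_le_mul h1 (ih' N) (abs_nonneg _) (by positivity))
        _ = (2 * harm N) ^ fs.length * (2 * harm (N + 1)) := by rw [hs]; ring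
        _ ≤ (2 * harm (N + 1)) ^ fs.length * (2 * harm (N + 1)) := by
            have := harm_nonneg (N + 1)
            gcongr

/-- Powers of harmonic numbers grow slower than `√N`, so that truncations of any depth are summable
against `1 / n²`. -/
lemma exists_harm_pow_le_sqrt (r : ℕ) :
    ∃ C : ℝ, 0 ≤ C ∧ ∀ N : ℕ, (2 * harm N) ^ r ≤ C * √((N : ℝ) + 1) := by
  rcases Nat.eq_zero_or_pos r with rfl | hr
  · refine ⟨1, zero_le_one, fun N => ?_⟩
    rw [pow_zero, one_mul]
    exact Real.one_le_sqrt.2 (by linarith [(Nat.cast_nonneg N : (0 : ℝ) ≤ N)])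
  have hr' : (0 : ℝ) < r := by exact_mod_cast hr
  set δ : ℝ := 1 / (2 * r) with hδ
  have hδ0 : 0 < δ := by positivity
  refine ⟨(2 * (1 + 1 / δ)) ^ r, by positivity, fun N => ?_⟩
  have hx : (1 : ℝ) ≤ (N : ℝ) + 1 := by linarith [(Nat.cast_nonneg N : (0 : ℝ) ≤ N)]
  have h1 : harm N ≤ 1 + Real.log ((N : ℝ) + 1) := by
    have h := harmonic_le_one_add_log N
    have e : ((harmonic N : ℚ) : ℝ) = harm N := by
      rw [harmonic, harm]
      push_cast
      exact sum_congr rfl fun i _ => by rw [one_div]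
    rw [e] at h
    refine h.trans ?_
    rcases Nat.eq_zero_or_pos N with rfl | hN
    · simp
    · have hN' : (0 : ℝ) < N := by exact_mod_cast hN
      have := Real.log_le_log hN' (by linarith : (N : ℝ) ≤ (N : ℝ) + 1)
      linarith
  have h2 := Real.log_le_rpow_div (by linarith : (0 : ℝ) ≤ (N : ℝ) + 1) hδ0
  have h3 : 1 ≤ ((N : ℝ) + 1) ^ δ := Real.one_le_rpow hx hδ0.le
  have h4 : harm N ≤ (1 + 1 / δ) * ((N : ℝ) + 1) ^ δ := by
    have : ((N : ℝ) + 1) ^ δ / δ = 1 / δ * ((N : ℝ) + 1) ^ δ := by ring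
    linarith
  have h5 := harm_nonneg N
  calc (2 * harm N) ^ r ≤ (2 * ((1 + 1 / δ) * ((N : ℝ) + 1) ^ δ)) ^ r := by gcongr
    _ = (2 * (1 + 1 / δ)) ^ r * (((N : ℝ) + 1) ^ δ) ^ r := by rw [← mul_assoc, mul_pow]
    _ = (2 * (1 + 1 / δ)) ^ r * √((N : ℝ) + 1) := by
        rw [← Real.rpow_natCast (((N : ℝ) + 1) ^ δ), ← Real.rpow_mul (by linarith),
          Real.sqrt_eq_rpow]
        congr 2
        rw [hδ]
        field_simp

lemma abs_le_of_mem_altTTerms_tailIndex (j : ℕ) :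
    ∀ f ∈ altTTerms (tailIndex j), ∀ n, |f n| ≤ 2 / (n : ℝ) := by
  induction j with
  | zero =>
    intro f hf n
    rw [altTTerms_tailIndex_zero, List.mem_singleton] at hf
    simpa [hf] using abs_mixedTerm_le (-1) (-1) 1 n
  | succ j ih =>
    intro f hf n
    rw [altTTerms_tailIndex_succ, List.mem_cons] at hf
    rcases hf with rfl | hf
    · simpa using abs_mixedTerm_le ((-1) ^ (j + 2)) 1 1 n
    · exact ih f hf n

/-- The truncations of the tail `({1}_j, 1̄)` of the index. -/
noncomputable def tailSum (j : ℕ) : ℕ → ℝ := nestedSum (altTTerms (tailIndex j))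

lemma tailSum_zero (j : ℕ) : tailSum j 0 = 0 := by
  rw [tailSum]
  cases j with
  | zero => rw [altTTerms_tailIndex_zero, nestedSum_cons_zero]
  | succ j => rw [altTTerms_tailIndex_succ, nestedSum_cons_zero]

lemma exists_abs_tailSum_le (j : ℕ) :
    ∃ C : ℝ, 0 ≤ C ∧ ∀ n : ℕ, |tailSum j n| ≤ C * √((n : ℝ) + 1) := by
  obtain ⟨C, hC0, hC⟩ := exists_harm_pow_le_sqrt (altTTerms (tailIndex j)).length
  exact ⟨C, hC0, fun n => (abs_nestedSum_le (abs_le_of_mem_altTTerms_tailIndex j) n).trans (hC n)⟩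

/-- The coefficients of the generating functions of the tails `({1}_j, 1̄)` on the imaginary axis:
the sign `(-1)^(n/2)` resp. `(-1)^((n+1)/2)` of `i^n` turns the leading entry into a barred one.
For `j = 0` the two bars cancel. -/
noncomputable def axisCoeff : ℕ → ℕ → ℝ
  | 0, n => mixedTerm (-1) 1 1 n
  | j + 1, n => mixedTerm ((-1) ^ (j + 2)) (-1) 1 n * tailSum j (n - 1)

lemma nestedSum_index21_term (j n : ℕ) :
    mixedTerm ((-1) ^ (j + 2)) (-1) 2 n * tailSum j (n - 1) = axisCoeff (j + 1) n / n := by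
  rw [axisCoeff, mixedTerm, mixedTerm]
  rcases eq_or_ne (n : ℝ) 0 with h | h
  · simp [h]
  · field_simp

lemma exists_abs_mul_axisCoeff_le (j : ℕ) :
    ∃ C : ℝ, 0 ≤ C ∧ ∀ n : ℕ, |((n : ℝ) + 1) * axisCoeff j (n + 1)| ≤ C * √((n : ℝ) + 1) := by
  have hb : ∀ (ε σ : ℤˣ) (n : ℕ), |((n : ℝ) + 1) * mixedTerm ε σ 1 (n + 1)| ≤ 2 := fun ε σ n => by
    have h := abs_mixedTerm_le ε σ 1 (n + 1)
    rw [pow_one, le_div_iff₀ (by positivity)] at h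
    push_cast at h
    rw [abs_mul, abs_of_nonneg (by positivity : (0 : ℝ) ≤ (n : ℝ) + 1), mul_comm]
    exact h
  cases j with
  | zero =>
    refine ⟨2, by norm_num, fun n => (hb _ _ n).trans ?_⟩
    have := Real.one_le_sqrt.2 (by linarith [(Nat.cast_nonneg n : (0 : ℝ) ≤ n)] :
      (1 : ℝ) ≤ (n : ℝ) + 1)
    linarith
  | succ j =>
    obtain ⟨C, hC0, hC⟩ := exists_abs_tailSum_le j
    refine ⟨2 * C, by positivity, fun n => ?_⟩
    rw [axisCoeff, Nat.add_sub_cancel, ← mul_assoc, abs_mul, mul_assoc 2 C]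
    exact mul_le_mul (hb _ _ n) (hC n) (abs_nonneg _) (by norm_num)

/-- The summand of `tailSum j`; it agrees with `axisCoeff j` up to sign. -/
noncomputable def tailTerm : ℕ → ℕ → ℝ
  | 0, n => mixedTerm (-1) (-1) 1 n
  | j + 1, n => mixedTerm ((-1) ^ (j + 2)) 1 1 n * tailSum j (n - 1)

lemma tailSum_succ (j n : ℕ) : tailSum j (n + 1) = tailSum j n + tailTerm j (n + 1) := by
  rw [tailSum]
  cases j with
  | zero => rw [altTTerms_tailIndex_zero, nestedSum_succ, tailTerm, nestedSum, mul_one]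
  | succ j => rw [altTTerms_tailIndex_succ, nestedSum_succ, tailTerm, Nat.add_sub_cancel, tailSum]

lemma tailSum_succ_of_tailTerm_eq_zero {j n : ℕ} (h : tailTerm j n = 0) :
    tailSum j (n + 1) = tailSum j (n - 1) + tailTerm j (n + 1) := by
  cases n with
  | zero => rw [tailSum_succ]
  | succ n => rw [tailSum_succ, tailSum_succ, h, add_zero, Nat.add_sub_cancel]

lemma neg_one_units_pow_even {j : ℕ} (hj : Even j) : ((-1 : ℤˣ)) ^ (j + 1) = -1 := by
  rw [pow_succ, hj.neg_one_pow, one_mul]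

lemma neg_one_units_pow_odd {j : ℕ} (hj : Odd j) : ((-1 : ℤˣ)) ^ (j + 1) = 1 := by
  rw [pow_succ, hj.neg_one_pow]; norm_num

lemma tailTerm_even_even {j : ℕ} (hj : Even j) (k : ℕ) : tailTerm j (2 * k) = 0 := by
  cases j with
  | zero => rw [tailTerm, mixedTerm_neg_one_even]
  | succ j => rw [tailTerm, neg_one_units_pow_even hj, mixedTerm_neg_one_even, zero_mul]

lemma tailTerm_odd_odd {j : ℕ} (hj : Odd j) (k : ℕ) : tailTerm j (2 * k + 1) = 0 := by
  cases j with
  | zero => exact absurd hj (by decide)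
  | succ j => rw [tailTerm, neg_one_units_pow_odd hj, mixedTerm_one_odd, zero_mul]

lemma axisCoeff_even_even {j : ℕ} (hj : Even j) (k : ℕ) : axisCoeff j (2 * k) = 0 := by
  cases j with
  | zero => rw [axisCoeff, mixedTerm_neg_one_even]
  | succ j => rw [axisCoeff, neg_one_units_pow_even hj, mixedTerm_neg_one_even, zero_mul]

lemma axisCoeff_odd_odd {j : ℕ} (hj : Odd j) (k : ℕ) : axisCoeff j (2 * k + 1) = 0 := by
  cases j with
  | zero => exact absurd hj (by decide)
  | succ j => rw [axisCoeff, neg_one_units_pow_odd hj, mixedTerm_one_odd, zero_mul]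

lemma axisCoeff_even_odd {j : ℕ} (hj : Even j) (k : ℕ) :
    axisCoeff j (2 * k + 1) = (-1) ^ (k + 1) * tailTerm j (2 * k + 1) := by
  have h : (-1 : ℝ) ^ (k + 1) * (-1) ^ (k + 1) = 1 := by rw [← mul_pow]; norm_num
  cases j with
  | zero =>
    rw [axisCoeff, tailTerm, mixedTerm_neg_one_odd, mixedTerm_neg_one_odd]
    push_cast
    linear_combination (-2 / (2 * (k : ℝ) + 1) ^ 1) * h
  | succ j =>
    rw [axisCoeff, tailTerm, neg_one_units_pow_even hj, mixedTerm_neg_one_odd,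
      mixedTerm_neg_one_odd]
    push_cast
    ring

lemma axisCoeff_odd_even {j : ℕ} (hj : Odd j) (k : ℕ) :
    axisCoeff j (2 * k) = (-1) ^ k * tailTerm j (2 * k) := by
  cases j with
  | zero => exact absurd hj (by decide)
  | succ j =>
    rw [axisCoeff, tailTerm, neg_one_units_pow_odd hj, mixedTerm_one_even, mixedTerm_one_even]
    push_cast
    ring

/-- The recursion behind the differential equation `(1 + y²) g_{j+1}'(y) = 2 (-1)^j g_j(y)`. -/
lemma axisCoeff_recursion (j n : ℕ) :
    ((n : ℝ) + 2) * axisCoeff (j + 1) (n + 2) + n * axisCoeff (j + 1) n =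
      2 * (-1) ^ j * axisCoeff j (n + 1) := by
  rcases Nat.even_or_odd j with hj | hj
  · have hj1 : Odd (j + 1) := hj.add_one
    rw [hj.neg_one_pow]
    rcases Nat.even_or_odd' n with ⟨k, rfl | rfl⟩
    · rw [axisCoeff, axisCoeff, neg_one_units_pow_odd hj1, show 2 * k + 2 = 2 * (k + 1) by ring,
        mixedTerm_one_even, mixedTerm_one_even, axisCoeff_even_odd hj,
        show 2 * (k + 1) - 1 = 2 * k + 1 by omega,
        tailSum_succ_of_tailTerm_eq_zero (tailTerm_even_even hj k)]
      rcases Nat.eq_zero_or_pos k with rfl | hk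
      · simp [tailSum_zero]
      · have : (k : ℝ) ≠ 0 := by exact_mod_cast hk.ne'
        push_cast
        field_simp
        ring
    · rw [show 2 * k + 1 + 2 = 2 * (k + 1) + 1 by ring, axisCoeff_odd_odd hj1,
        axisCoeff_odd_odd hj1, show 2 * k + 1 + 1 = 2 * (k + 1) by ring, axisCoeff_even_even hj]
      ring
  · have hj1 : Even (j + 1) := hj.add_one
    rw [hj.neg_one_pow]
    rcases Nat.even_or_odd' n with ⟨k, rfl | rfl⟩
    · rw [show 2 * k + 2 = 2 * (k + 1) by ring, axisCoeff_even_even hj1,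
        axisCoeff_even_even hj1, axisCoeff_odd_odd hj]
      ring
    · rw [axisCoeff, axisCoeff, neg_one_units_pow_even hj1,
        show 2 * k + 1 + 2 = 2 * (k + 1) + 1 by ring, mixedTerm_neg_one_odd, mixedTerm_neg_one_odd,
        show 2 * k + 1 + 1 = 2 * (k + 1) by ring, axisCoeff_odd_even hj,
        show 2 * (k + 1) + 1 - 1 = 2 * k + 1 + 1 by omega,
        tailSum_succ_of_tailTerm_eq_zero (tailTerm_odd_odd hj k),
        show 2 * k + 1 + 1 = 2 * (k + 1) by ring]
      push_cast
      field_simp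
      ring

lemma axisCoeff_succ_one (j : ℕ) : axisCoeff (j + 1) 1 = 0 := by
  rw [axisCoeff, Nat.sub_self, tailSum_zero, mul_zero]

/-! ### Generating functions on the imaginary axis -/

/-- The generating function `g_j(y) = ∑ c_j(n) y^n` of the coefficients `axisCoeff j`. -/
noncomputable def axisFun (j : ℕ) (y : ℝ) : ℝ := ∑' n : ℕ, axisCoeff j (n + 1) * y ^ (n + 1)

/-- The termwise derivative of `axisFun`. -/
noncomputable def axisFunDeriv (j : ℕ) (y : ℝ) : ℝ :=
  ∑' n : ℕ, ((n : ℝ) + 1) * axisCoeff j (n + 1) * y ^ n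

lemma exists_abs_mul_axisCoeff_mul_pow_le (j : ℕ) {r : ℝ} (hr0 : 0 ≤ r) (hr : r < 1) :
    ∃ u : ℕ → ℝ, Summable u ∧ ∀ (n : ℕ) (y : ℝ), |y| ≤ r →
      |((n : ℝ) + 1) * axisCoeff j (n + 1) * y ^ n| ≤ u n := by
  obtain ⟨C, hC0, hC⟩ := exists_abs_mul_axisCoeff_le j
  refine ⟨fun n => C * ((n : ℝ) ^ 1 * r ^ n) + C * r ^ n, ?_, fun n y hy => ?_⟩
  · have hr' : ‖r‖ < 1 := by rwa [Real.norm_of_nonneg hr0]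
    exact ((summable_pow_mul_geometric_of_norm_lt_one 1 hr').mul_left C).add
      ((summable_geometric_of_lt_one hr0 hr).mul_left C)
  · rw [abs_mul, abs_pow]
    have h1 : √((n : ℝ) + 1) ≤ (n : ℝ) + 1 := by
      have : (0 : ℝ) ≤ n := Nat.cast_nonneg n
      rw [Real.sqrt_le_left (by linarith)]
      nlinarith
    calc |((n : ℝ) + 1) * axisCoeff j (n + 1)| * |y| ^ n ≤ (C * ((n : ℝ) + 1)) * r ^ n := by
          gcongr
          exact (hC n).trans (by gcongr)
      _ = _ := by ring

lemma summable_axisFunDeriv (j : ℕ) {y : ℝ} (hy : |y| < 1) :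
    Summable fun n : ℕ => ((n : ℝ) + 1) * axisCoeff j (n + 1) * y ^ n := by
  obtain ⟨u, hu, h⟩ := exists_abs_mul_axisCoeff_mul_pow_le j (abs_nonneg y) hy
  exact Summable.of_norm_bounded hu fun n => h n y le_rfl

lemma summable_axisFun (j : ℕ) {y : ℝ} (hy : |y| < 1) :
    Summable fun n : ℕ => axisCoeff j (n + 1) * y ^ (n + 1) := by
  obtain ⟨u, hu, h⟩ := exists_abs_mul_axisCoeff_mul_pow_le j (abs_nonneg y) hy
  refine Summable.of_norm_bounded hu fun n => le_trans ?_ (h n y le_rfl)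
  rw [Real.norm_eq_abs, abs_mul, abs_mul, abs_mul, abs_pow, abs_pow]
  have h1 : (1 : ℝ) ≤ |(n : ℝ) + 1| := by
    rw [abs_of_nonneg (by positivity)]
    linarith [(Nat.cast_nonneg n : (0 : ℝ) ≤ n)]
  have h2 : |y| ^ (n + 1) ≤ |y| ^ n := pow_le_pow_of_le_one (abs_nonneg y) hy.le (Nat.le_succ n)
  calc |axisCoeff j (n + 1)| * |y| ^ (n + 1) ≤ 1 * |axisCoeff j (n + 1)| * |y| ^ n := by
        rw [one_mul]; gcongr
    _ ≤ _ := by gcongr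

lemma hasDerivAt_axisFun (j : ℕ) {y : ℝ} (hy : |y| < 1) :
    HasDerivAt (axisFun j) (axisFunDeriv j y) y := by
  obtain ⟨r, hyr, hr⟩ := exists_between hy
  have hr0 : 0 < r := (abs_nonneg y).trans_lt hyr
  obtain ⟨u, hu, h⟩ := exists_abs_mul_axisCoeff_mul_pow_le j hr0.le hr
  have hg : ∀ (n : ℕ) (x : ℝ), x ∈ Metric.ball (0 : ℝ) r →
      HasDerivAt (fun x : ℝ => axisCoeff j (n + 1) * x ^ (n + 1))
        (((n : ℝ) + 1) * axisCoeff j (n + 1) * x ^ n) x := fun n x _ => by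
    have := (hasDerivAt_pow (n + 1) x).const_mul (axisCoeff j (n + 1))
    refine this.congr_deriv ?_
    rw [Nat.add_sub_cancel]
    push_cast
    ring
  have hg' : ∀ (n : ℕ) (x : ℝ), x ∈ Metric.ball (0 : ℝ) r →
      ‖((n : ℝ) + 1) * axisCoeff j (n + 1) * x ^ n‖ ≤ u n := fun n x hx =>
    h n x (by simpa using (Metric.mem_ball.1 hx).le)
  exact hasDerivAt_tsum_of_isPreconnected (y₀ := 0) hu Metric.isOpen_ball
    (convex_ball 0 r).isPreconnected hg hg' (Metric.mem_ball_self hr0)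
    (summable_axisFun j (by simp)) (by simpa using hyr)

lemma one_add_sq_mul_axisFunDeriv_succ (j : ℕ) {y : ℝ} (hy : |y| < 1) :
    (1 + y ^ 2) * axisFunDeriv (j + 1) y = 2 * (-1) ^ j * axisFun j y := by
  have hd := summable_axisFunDeriv (j + 1) hy
  have hf := summable_axisFun j hy
  have e1 : axisFunDeriv (j + 1) y = 2 * (-1) ^ j * axisCoeff j 1 * y +
      ∑' n : ℕ, ((n : ℝ) + 3) * axisCoeff (j + 1) (n + 3) * y ^ (n + 2) := by
    rw [axisFunDeriv, ← hd.sum_add_tsum_nat_add 2, sum_range_succ, sum_range_one]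
    congr 1
    · have := axisCoeff_recursion j 0
      norm_num at this
      rw [axisCoeff_succ_one]
      push_cast
      rw [← this]
      ring
    · refine tsum_congr fun n => ?_
      push_cast
      ring_nf
  have e2 : axisFun j y = axisCoeff j 1 * y +
      ∑' n : ℕ, axisCoeff j (n + 2) * y ^ (n + 2) := by
    rw [axisFun, ← hf.sum_add_tsum_nat_add 1, sum_range_one]
    simp
  have hd2 : Summable fun n : ℕ => ((n : ℝ) + 3) * axisCoeff (j + 1) (n + 3) * y ^ (n + 2) := by
    refine ((summable_nat_add_iff 2).2 hd).congr fun n => ?_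
    push_cast
    ring_nf
  have e3 : y ^ 2 * axisFunDeriv (j + 1) y =
      ∑' n : ℕ, ((n : ℝ) + 1) * axisCoeff (j + 1) (n + 1) * y ^ (n + 2) := by
    rw [axisFunDeriv, ← tsum_mul_left]
    refine tsum_congr fun n => ?_
    ring
  have hd3 : Summable fun n : ℕ => ((n : ℝ) + 1) * axisCoeff (j + 1) (n + 1) * y ^ (n + 2) := by
    refine (hd.mul_left (y ^ 2)).congr fun n => ?_
    ring
  rw [add_mul, one_mul, e3, e1, e2, add_assoc, ← hd2.tsum_add hd3, mul_add, ← tsum_mul_left]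
  congr 1
  · ring
  · refine tsum_congr fun n => ?_
    have := axisCoeff_recursion j (n + 1)
    push_cast at this
    rw [show n + 1 + 2 = n + 3 by ring, show n + 1 + 1 = n + 2 by ring] at this
    linear_combination y ^ (n + 2) * this

lemma one_sub_sq_mul_axisFunDeriv_zero {y : ℝ} (hy : |y| < 1) :
    (1 - y ^ 2) * axisFunDeriv 0 y = 2 := by
  have hd := summable_axisFunDeriv 0 hy
  have hc : ∀ n : ℕ, ((n : ℝ) + 3) * axisCoeff 0 (n + 3) = ((n : ℝ) + 1) * axisCoeff 0 (n + 1) := by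
    intro n
    rw [axisCoeff, axisCoeff]
    rcases Nat.even_or_odd' n with ⟨k, rfl | rfl⟩
    · rw [show 2 * k + 3 = 2 * (k + 1) + 1 by ring, mixedTerm_neg_one_odd, mixedTerm_neg_one_odd]
      push_cast
      field_simp
      ring
    · rw [show 2 * k + 1 + 3 = 2 * (k + 2) by ring, show 2 * k + 1 + 1 = 2 * (k + 1) by ring,
        mixedTerm_neg_one_even, mixedTerm_neg_one_even, mul_zero, mul_zero]
  have c1 : axisCoeff 0 1 = 2 := by
    simpa [axisCoeff] using mixedTerm_neg_one_odd 1 1 0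
  have c2 : axisCoeff 0 2 = 0 := by
    rw [axisCoeff, show 2 = 2 * 1 by rfl, mixedTerm_neg_one_even]
  have e1 : axisFunDeriv 0 y = 2 +
      ∑' n : ℕ, ((n : ℝ) + 1) * axisCoeff 0 (n + 1) * y ^ (n + 2) := by
    rw [axisFunDeriv, ← hd.sum_add_tsum_nat_add 2, sum_range_succ, sum_range_one]
    congr 1
    · simp [c1, c2]
    · refine tsum_congr fun n => ?_
      rw [← hc n]
      push_cast
      ring_nf
  have e3 : y ^ 2 * axisFunDeriv 0 y =
      ∑' n : ℕ, ((n : ℝ) + 1) * axisCoeff 0 (n + 1) * y ^ (n + 2) := by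
    rw [axisFunDeriv, ← tsum_mul_left]
    refine tsum_congr fun n => ?_
    ring
  rw [sub_mul, e3, one_mul, e1]
  ring

/-- The signs of the iterated antiderivatives: `1, 1, -1, -1, 1, 1, …`. -/
def axisSign : ℕ → ℝ
  | 0 => 1
  | j + 1 => (-1) ^ j * axisSign j

lemma axisSign_mul_self (j : ℕ) : axisSign j * axisSign j = 1 := by
  induction j with
  | zero => norm_num [axisSign]
  | succ j ih =>
    rw [axisSign, mul_mul_mul_comm, ih, ← mul_pow]
    norm_num

/-- The generating function in the angular coordinate `b = 2 arctan y`. -/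
noncomputable def angleFun (j : ℕ) (b : ℝ) : ℝ := axisSign j * axisFun j (Real.tan (b / 2))

lemma cos_half_pos {b : ℝ} (hb : b ∈ Set.Ico 0 (Real.pi / 2)) : 0 < Real.cos (b / 2) :=
  Real.cos_pos_of_mem_Ioo ⟨by linarith [hb.1, Real.pi_pos], by linarith [hb.2, Real.pi_pos]⟩

lemma cos_pos_of_mem_Ico {b : ℝ} (hb : b ∈ Set.Ico 0 (Real.pi / 2)) : 0 < Real.cos b :=
  Real.cos_pos_of_mem_Ioo ⟨by linarith [hb.1, Real.pi_pos], hb.2⟩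

lemma abs_tan_half_lt_one {b : ℝ} (hb : b ∈ Set.Ico 0 (Real.pi / 2)) :
    |Real.tan (b / 2)| < 1 := by
  have h1 := cos_half_pos hb
  have h2 := cos_pos_of_mem_Ico hb
  have h3 : Real.cos b = Real.cos (b / 2) ^ 2 - Real.sin (b / 2) ^ 2 := by
    rw [← Real.cos_two_mul']
    ring_nf
  rw [Real.tan_eq_sin_div_cos, abs_div, abs_of_pos h1, div_lt_one h1]
  refine abs_lt_of_sq_lt_sq ?_ h1.le
  linarith

lemma hasDerivAt_tan_half {b : ℝ} (hb : b ∈ Set.Ico 0 (Real.pi / 2)) :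
    HasDerivAt (fun b => Real.tan (b / 2)) ((1 + Real.tan (b / 2) ^ 2) / 2) b := by
  have h1 := (cos_half_pos hb).ne'
  have := (Real.hasDerivAt_tan h1).comp b ((hasDerivAt_id b).div_const 2)
  refine this.congr_deriv ?_
  have h2 := Real.sin_sq_add_cos_sq (b / 2)
  rw [Real.tan_eq_sin_div_cos]
  field_simp
  linarith

lemma hasDerivAt_angleFun_zero {b : ℝ} (hb : b ∈ Set.Ico 0 (Real.pi / 2)) :
    HasDerivAt (angleFun 0) (1 / Real.cos b) b := by
  have h := ((hasDerivAt_axisFun 0 (abs_tan_half_lt_one hb)).comp b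
    (hasDerivAt_tan_half hb)).const_mul (axisSign 0)
  refine h.congr_deriv ?_
  have h1 := one_sub_sq_mul_axisFunDeriv_zero (abs_tan_half_lt_one hb)
  have h2 := (cos_pos_of_mem_Ico hb).ne'
  have h3 := (cos_half_pos hb).ne'
  have h4 : Real.cos b = Real.cos (b / 2) ^ 2 - Real.sin (b / 2) ^ 2 := by
    rw [← Real.cos_two_mul']
    ring_nf
  have h5 : Real.cos b * (1 + Real.tan (b / 2) ^ 2) = 1 - Real.tan (b / 2) ^ 2 := by
    have h6 := Real.sin_sq_add_cos_sq (b / 2)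
    rw [h4, Real.tan_eq_sin_div_cos]
    field_simp
    linear_combination (Real.cos (b / 2) ^ 2 - Real.sin (b / 2) ^ 2) * h6
  rw [axisSign, one_mul, eq_div_iff h2]
  linear_combination (axisFunDeriv 0 (Real.tan (b / 2)) / 2) * h5 + h1 / 2

lemma hasDerivAt_angleFun_succ (j : ℕ) {b : ℝ} (hb : b ∈ Set.Ico 0 (Real.pi / 2)) :
    HasDerivAt (angleFun (j + 1)) (angleFun j b) b := by
  have h := ((hasDerivAt_axisFun (j + 1) (abs_tan_half_lt_one hb)).comp b
    (hasDerivAt_tan_half hb)).const_mul (axisSign (j + 1))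
  refine h.congr_deriv ?_
  have h1 := one_add_sq_mul_axisFunDeriv_succ j (abs_tan_half_lt_one hb)
  have h2 : (-1 : ℝ) ^ j * (-1) ^ j = 1 := by rw [← mul_pow]; norm_num
  rw [axisSign, angleFun]
  linear_combination ((-1) ^ j * axisSign j / 2) * h1 +
    axisSign j * axisFun j (Real.tan (b / 2)) * h2

lemma angleFun_apply_zero (j : ℕ) : angleFun j 0 = 0 := by
  simp [angleFun, axisFun]

lemma angleFun_eq_integral (j : ℕ) {b : ℝ} (hb : b ∈ Set.Ioo 0 (Real.pi / 2)) :
    angleFun j b = ∫ a in (0 : ℝ)..b, (b - a) ^ j / (j.factorial : ℝ) * (1 / Real.cos a) := by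
  have hsub : ∀ a ∈ Set.uIcc 0 b, a ∈ Set.Ico 0 (Real.pi / 2) := fun a ha => by
    rw [Set.uIcc_of_le hb.1.le] at ha
    exact ⟨ha.1, ha.2.trans_lt hb.2⟩
  exact eq_integral_of_iterated_antideriv (fun a ha => hasDerivAt_angleFun_zero (hsub a ha))
    (fun j a ha => hasDerivAt_angleFun_succ j (hsub a ha)) angleFun_apply_zero
    (ContinuousOn.div (by fun_prop) (by fun_prop) fun a ha => (cos_pos_of_mem_Ico (hsub a ha)).ne')
    j

lemma angleFun_nonneg (j : ℕ) {b : ℝ} (hb : b ∈ Set.Ioo 0 (Real.pi / 2)) : 0 ≤ angleFun j b := by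
  rw [angleFun_eq_integral j hb]
  refine intervalIntegral.integral_nonneg hb.1.le fun a ha => ?_
  have h1 := cos_pos_of_mem_Ico (b := a) ⟨ha.1, ha.2.trans_lt hb.2⟩
  have h2 : 0 ≤ b - a := by linarith [ha.2]
  positivity

lemma summable_axisCoeff_div (j : ℕ) :
    Summable fun n : ℕ => |axisCoeff j (n + 1)| / ((n : ℝ) + 1) := by
  obtain ⟨C, hC0, hC⟩ := exists_abs_mul_axisCoeff_le j
  refine Summable.of_nonneg_of_le (fun n => by positivity) (fun n => ?_)
    (summable_sqrt_div_sq.mul_left C)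
  have h := hC n
  rw [abs_mul, abs_of_nonneg (by positivity : (0 : ℝ) ≤ (n : ℝ) + 1)] at h
  rw [mul_div_assoc', div_le_div_iff₀ (by positivity) (by positivity)]
  calc |axisCoeff j (n + 1)| * ((n : ℝ) + 1) ^ 2
      = ((n : ℝ) + 1) * |axisCoeff j (n + 1)| * ((n : ℝ) + 1) := by ring
    _ ≤ _ := by gcongr

lemma continuousOn_tan_half_pow (n : ℕ) : ContinuousOn
    (fun b => Real.tan (b / 2) ^ n * ((1 + Real.tan (b / 2) ^ 2) / 2))
    (Set.Icc 0 (Real.pi / 2)) := by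
  have h : ContinuousOn (fun b : ℝ => Real.tan (b / 2)) (Set.Icc 0 (Real.pi / 2)) := by
    refine Real.continuousOn_tan_Ioo.comp (by fun_prop) fun b hb => ?_
    exact ⟨by linarith [hb.1, Real.pi_pos], by linarith [hb.2, Real.pi_pos]⟩
  fun_prop

lemma integral_tan_half_pow (n : ℕ) :
    ∫ b in Set.Ioo 0 (Real.pi / 2), Real.tan (b / 2) ^ n * ((1 + Real.tan (b / 2) ^ 2) / 2) =
      1 / ((n : ℝ) + 1) := by
  have hpi : (0 : ℝ) ≤ Real.pi / 2 := by positivity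
  have hd : ∀ b ∈ Set.uIcc 0 (Real.pi / 2), HasDerivAt
      (fun b => Real.tan (b / 2) ^ (n + 1) / ((n : ℝ) + 1))
      (Real.tan (b / 2) ^ n * ((1 + Real.tan (b / 2) ^ 2) / 2)) b := by
    intro b hb
    rw [Set.uIcc_of_le hpi] at hb
    have h1 : Real.cos (b / 2) ≠ 0 := (Real.cos_pos_of_mem_Ioo
      ⟨by linarith [hb.1, Real.pi_pos], by linarith [hb.2, Real.pi_pos]⟩).ne'
    have h3 := (((Real.hasDerivAt_tan h1).comp b ((hasDerivAt_id b).div_const 2)).pow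
      (n + 1)).div_const ((n : ℝ) + 1)
    refine h3.congr_deriv ?_
    have h2 := Real.sin_sq_add_cos_sq (b / 2)
    have h4 : 1 / Real.cos (b / 2) ^ 2 = 1 + Real.tan (b / 2) ^ 2 := by
      rw [Real.tan_eq_sin_div_cos]
      field_simp
      linarith
    simp only [Function.comp_apply, id_eq, h4, Nat.add_sub_cancel]
    push_cast
    field_simp
  rw [← integral_Ioc_eq_integral_Ioo, ← intervalIntegral.integral_of_le hpi,
    intervalIntegral.integral_eq_sub_of_hasDerivAt hd]
  · have : Real.pi / 2 / 2 = Real.pi / 4 := by ring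
    simp [this]
  · refine ContinuousOn.intervalIntegrable ?_
    rw [Set.uIcc_of_le hpi]
    exact continuousOn_tan_half_pow n

/-- The last integration, against `dy / y = db / sin b`. The series `∑ c_j(n) / n` converges
absolutely, so it may be done termwise up to the endpoint `y = 1`. -/
lemma hasSum_axisCoeff_div (j : ℕ) :
    HasSum (fun n : ℕ => axisCoeff j (n + 1) / ((n : ℝ) + 1))
      (∫ b in Set.Ioo 0 (Real.pi / 2), axisFun j (Real.tan (b / 2)) / Real.sin b) := by
  have hint : ∀ n : ℕ, IntegrableOn (fun b => Real.tan (b / 2) ^ n *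
      ((1 + Real.tan (b / 2) ^ 2) / 2)) (Set.Ioo 0 (Real.pi / 2)) := fun n =>
    ((continuousOn_tan_half_pow n).integrableOn_Icc).mono_set Set.Ioo_subset_Icc_self
  have h := hasSum_integral_of_summable_integral_norm
    (μ := volume.restrict (Set.Ioo 0 (Real.pi / 2)))
    (F := fun (n : ℕ) (b : ℝ) => axisCoeff j (n + 1) * (Real.tan (b / 2) ^ n *
      ((1 + Real.tan (b / 2) ^ 2) / 2))) (fun n => (hint n).const_mul _) (by
      refine (summable_axisCoeff_div j).congr fun n => ?_
      rw [div_eq_mul_one_div, ← integral_tan_half_pow, ← integral_const_mul]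
      refine setIntegral_congr_fun measurableSet_Ioo fun b hb => ?_
      have h0 : 0 ≤ Real.tan (b / 2) := Real.tan_nonneg_of_nonneg_of_le_pi_div_two
        (by linarith [hb.1]) (by linarith [hb.2, hb.1])
      rw [norm_mul, Real.norm_eq_abs, Real.norm_of_nonneg (by positivity)])
  simp_rw [integral_const_mul, integral_tan_half_pow, mul_one_div] at h
  suffices hr : ∫ b in Set.Ioo 0 (Real.pi / 2), axisFun j (Real.tan (b / 2)) / Real.sin b =
      ∫ b in Set.Ioo 0 (Real.pi / 2), ∑' n : ℕ, axisCoeff j (n + 1) * (Real.tan (b / 2) ^ n *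
        ((1 + Real.tan (b / 2) ^ 2) / 2)) by rwa [hr]
  refine setIntegral_congr_fun measurableSet_Ioo fun b hb => ?_
  have hc := (cos_half_pos ⟨hb.1.le, hb.2⟩).ne'
  have hs : Real.sin (b / 2) ≠ 0 :=
    (Real.sin_pos_of_pos_of_lt_pi (by linarith [hb.1]) (by linarith [hb.2, Real.pi_pos])).ne'
  have e : ∀ n : ℕ, axisCoeff j (n + 1) * (Real.tan (b / 2) ^ n *
      ((1 + Real.tan (b / 2) ^ 2) / 2)) =
      axisCoeff j (n + 1) * Real.tan (b / 2) ^ (n + 1) / Real.sin b := by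
    intro n
    have h1 : Real.sin b = 2 * Real.sin (b / 2) * Real.cos (b / 2) := by
      rw [← Real.sin_two_mul]
      ring_nf
    have h2 := Real.sin_sq_add_cos_sq (b / 2)
    have h3 : (1 + Real.tan (b / 2) ^ 2) / 2 = Real.tan (b / 2) / Real.sin b := by
      rw [h1, Real.tan_eq_sin_div_cos]
      field_simp
      linarith
    rw [h3]
    ring
  simp_rw [e]
  rw [tsum_div_const, axisFun]

lemma tendsto_nestedSum_index21 (j : ℕ) :
    Tendsto (nestedSum (altTTerms (index21 (j + 1)))) atTop
      (𝓝 (∫ b in Set.Ioo 0 (Real.pi / 2), axisFun (j + 1) (Real.tan (b / 2)) / Real.sin b)) := by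
  refine (hasSum_axisCoeff_div (j + 1)).tendsto_sum_nat.congr fun N => ?_
  rw [altTTerms_index21_succ]
  induction N with
  | zero => rw [nestedSum_cons_zero, sum_range_zero]
  | succ N ih =>
    rw [sum_range_succ, ih, nestedSum_succ]
    congr 1
    have := nestedSum_index21_term j (N + 1)
    rw [Nat.add_sub_cancel, tailSum] at this
    rw [this]
    push_cast
    rfl

/-- The alternating multiple `T`-value as a single series of cosine moments. -/
theorem altT_index21 (j : ℕ) :
    altT (index21 (j + 1)) = axisSign (j + 1) * (4 / ((j + 1).factorial : ℝ) *
      ∑' l, alpha l * cosMoment (j + 1) l) := by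
  have hlim : altT (index21 (j + 1)) = _ := nestedLim_eq (tendsto_nestedSum_index21 j)
  set m := j + 1 with hm
  have h1 : ∀ b, axisFun m (Real.tan (b / 2)) / Real.sin b =
      axisSign m * (angleFun m b / Real.sin b) := fun b => by
    rw [angleFun, mul_div_assoc', ← mul_assoc, axisSign_mul_self, one_mul]
  rw [hlim]
  simp_rw [h1]
  rw [integral_const_mul]
  congr 1
  -- positivity permits passing to lower integrals, where no integrability has to be checked
  rw [integral_eq_lintegral_of_nonneg_ae, lintegral_triangleKer m fun b hb =>
    angleFun_eq_integral m hb, lintegral_triangleKer_eq]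
  · have hf : (0 : ℝ) ≤ 1 / (m.factorial : ℝ) := by positivity
    have e : ∀ c : ℝ, ENNReal.ofReal (c ^ m * logSinDivCos c / (m.factorial : ℝ)) =
        ENNReal.ofReal (1 / (m.factorial : ℝ)) * ENNReal.ofReal (c ^ m * logSinDivCos c) := by
      intro c
      rw [← ENNReal.ofReal_mul hf]
      congr 1
      ring
    simp_rw [e]
    rw [lintegral_const_mul' _ _ ENNReal.ofReal_ne_top, ENNReal.toReal_mul,
      ENNReal.toReal_ofReal hf, lintegral_pow_mul_logSinDivCos]
    ring
  · refine (ae_restrict_mem measurableSet_Ioo).mono fun b hb => ?_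
    exact div_nonneg (angleFun_nonneg m hb) (sin_pos_of_mem hb).le
  · refine ContinuousOn.aestronglyMeasurable (ContinuousOn.div (fun b hb => ?_) (by fun_prop)
      fun b hb => (sin_pos_of_mem hb).ne') measurableSet_Ioo
    exact (hasDerivAt_angleFun_succ j ⟨hb.1.le, hb.2⟩).continuousAt.continuousWithinAt

/-! ### Depth two polylogarithms -/

lemma nestedSum_singleton {R : Type*} [CommSemiring R] (f : ℕ → R) (N : ℕ) :
    nestedSum [f] N = ∑ n ∈ range N, f (n + 1) := by
  induction N with
  | zero => rw [nestedSum_cons_zero, sum_range_zero]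
  | succ N ih => rw [nestedSum_succ, ih, sum_range_succ, nestedSum, mul_one]

lemma nestedSum_pair {R : Type*} [CommSemiring R] (f g : ℕ → R) (N : ℕ) :
    nestedSum [f, g] N = ∑ n ∈ range N, f (n + 1) * ∑ k ∈ range n, g (k + 1) := by
  induction N with
  | zero => rw [nestedSum_cons_zero, sum_range_zero]
  | succ N ih => rw [nestedSum_succ, ih, sum_range_succ, nestedSum_singleton]

lemma nestedSum_pair_eq_sum_inner (f g : ℕ → ℂ) (N : ℕ) :
    nestedSum [f, g] N = ∑ k ∈ range N, g (k + 1) *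
      (∑ n ∈ range N, f (n + 1) - ∑ n ∈ range (k + 1), f (n + 1)) := by
  rw [nestedSum_pair]
  induction N with
  | zero => rw [sum_range_zero, sum_range_zero]
  | succ N ih =>
    rw [sum_range_succ, ih, sum_range_succ _ N, sub_self, mul_zero, add_zero, mul_sum,
      ← sum_add_distrib]
    refine sum_congr rfl fun k _ => ?_
    rw [sum_range_succ _ N]
    ring

/-- Summation of a double series over the inner index first: it suffices that the outer series
converges, conditionally, and that the inner one converges absolutely. -/
lemma tendsto_nestedSum_pair {f g : ℕ → ℂ} {S : ℂ}
    (hf : Tendsto (fun N => ∑ n ∈ range N, f (n + 1)) atTop (𝓝 S))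
    (hg : Summable fun k => ‖g (k + 1)‖) :
    Summable (fun k => g (k + 1) * (S - ∑ n ∈ range (k + 1), f (n + 1))) ∧
      Tendsto (nestedSum [f, g]) atTop
        (𝓝 (∑' k, g (k + 1) * (S - ∑ n ∈ range (k + 1), f (n + 1)))) := by
  obtain ⟨C, hC⟩ := hf.norm.bddAbove_range
  have hC' : ∀ N, ‖∑ n ∈ range N, f (n + 1)‖ ≤ C := fun N => hC ⟨N, rfl⟩
  have hF : ∀ N k : ℕ, ‖∑ n ∈ range N, f (n + 1) - ∑ n ∈ range (k + 1), f (n + 1)‖ ≤ C + C :=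
    fun N k => (norm_sub_le _ _).trans (add_le_add (hC' _) (hC' _))
  have hlim : ∀ k : ℕ, Tendsto (fun N => ∑ n ∈ range N, f (n + 1) -
      ∑ n ∈ range (k + 1), f (n + 1)) atTop (𝓝 (S - ∑ n ∈ range (k + 1), f (n + 1))) :=
    fun k => hf.sub_const _
  refine ⟨Summable.of_norm_bounded (hg.mul_right (C + C)) fun k => ?_, ?_⟩
  · rw [norm_mul]
    exact mul_le_mul_of_nonneg_left (le_of_tendsto' (hlim k).norm fun N => hF N k) (norm_nonneg _)
  · exact (tendsto_sum_range_mul_of_dominated (hg.mul_right (C + C)) hF hlim).congr fun N =>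
      (nestedSum_pair_eq_sum_inner f g N).symm

/-- Truncations of `Li₁(z)`. -/
noncomputable def logSum (z : ℂ) (N : ℕ) : ℂ := ∑ n ∈ range N, z ^ (n + 1) / ((n + 1 : ℕ) : ℂ) ^ 1

/-- Dirichlet's test on the unit circle. -/
lemma exists_tendsto_logSum {z : ℂ} (hz : ‖z‖ = 1) (hz1 : z ≠ 1) :
    ∃ S, Tendsto (logSum z) atTop (𝓝 S) := by
  have hanti : Antitone fun n : ℕ => 1 / ((n : ℝ) + 1) := fun a b h => by
    have : (a : ℝ) ≤ b := by exact_mod_cast h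
    dsimp only
    gcongr
  have hb : ∀ n, ‖∑ i ∈ range n, z ^ (i + 1)‖ ≤ 2 / ‖z - 1‖ := by
    intro n
    have h0 : z - 1 ≠ 0 := sub_ne_zero.2 hz1
    have e : ∑ i ∈ range n, z ^ (i + 1) = z * ((z ^ n - 1) / (z - 1)) := by
      rw [← geom_sum_eq hz1, mul_sum]
      exact sum_congr rfl fun i _ => pow_succ' z i
    rw [e, norm_mul, hz, one_mul, norm_div]
    gcongr
    refine (norm_sub_le _ _).trans ?_
    rw [norm_pow, hz]
    norm_num
  have h := hanti.cauchySeq_series_mul_of_tendsto_zero_of_bounded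
    tendsto_one_div_add_atTop_nhds_zero_nat hb
  obtain ⟨S, hS⟩ := cauchySeq_tendsto_of_complete h
  refine ⟨S, hS.congr fun N => sum_congr rfl fun n _ => ?_⟩
  rw [Complex.real_smul]
  push_cast
  ring

lemma logSum_neg_one (N : ℕ) :
    logSum (-1) N = ((-∑ i ∈ range N, (-1 : ℝ) ^ i / (((0 : ℕ) : ℝ) + i + 1) : ℝ) : ℂ) := by
  rw [logSum]
  push_cast
  rw [← sum_neg_distrib]
  refine sum_congr rfl fun n _ => ?_
  rw [pow_one, zero_add, pow_succ]
  ring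

lemma tendsto_logSum_neg_one : Tendsto (logSum (-1)) atTop (𝓝 (-alpha 0 : ℝ)) := by
  have h := (tendsto_sum_range_alternating 0).neg
  exact ((Complex.continuous_ofReal.tendsto _).comp h).congr fun N => (logSum_neg_one N).symm

/-- The truncations of `Li₁(-1)` at odd length, as harmonic numbers. -/
lemma sum_range_odd_alternating (l : ℕ) :
    -∑ i ∈ range (2 * l + 1), (-1 : ℝ) ^ i / (((0 : ℕ) : ℝ) + i + 1) =
      harm l - harm (2 * l + 1) := by
  induction l with
  | zero => simp [harm]
  | succ l ih =>
    have h1 : (-1 : ℝ) ^ (2 * l + 1) = -1 := by rw [pow_succ, pow_mul]; norm_num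
    rw [show 2 * (l + 1) + 1 = 2 * l + 1 + 1 + 1 by ring, sum_range_succ, sum_range_succ,
      pow_succ _ (2 * l + 1), h1]
    have e1 : harm (2 * l + 1 + 1 + 1) = harm (2 * l + 1) + 1 / (((2 * l + 1 : ℕ) : ℝ) + 1) +
        1 / (((2 * l + 1 + 1 : ℕ) : ℝ) + 1) := by
      rw [harm, sum_range_succ, sum_range_succ, ← harm]
    have e2 : harm (l + 1) = harm l + 1 / ((l : ℝ) + 1) := by rw [harm, sum_range_succ, ← harm]
    rw [e1, e2]
    rw [neg_eq_iff_eq_neg] at ih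
    rw [ih]
    push_cast
    field_simp
    ring

/-- The truncations of `Li₁(i) + Li₁(-i)`, which are real. -/
noncomputable def reLogSum (N : ℕ) : ℝ :=
  ∑ n ∈ range N, 2 * (Complex.I ^ (n + 1)).re / ((n : ℝ) + 1)

lemma logSum_I_add_logSum_neg_I (N : ℕ) :
    logSum Complex.I N + logSum (-Complex.I) N = (reLogSum N : ℂ) := by
  rw [logSum, logSum, reLogSum, ← sum_add_distrib]
  push_cast
  refine sum_congr rfl fun n _ => ?_
  have h : (-Complex.I) ^ (n + 1) = (starRingEnd ℂ) (Complex.I ^ (n + 1)) := by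
    rw [map_pow, Complex.conj_I]
  rw [h, pow_one, ← add_div, Complex.add_conj]
  push_cast
  rfl

lemma I_pow_two_mul (l : ℕ) : Complex.I ^ (2 * l) = ((-1 : ℝ) ^ l : ℝ) := by
  rw [pow_mul, Complex.I_sq]
  push_cast
  rfl

lemma reLogSum_odd (l : ℕ) :
    reLogSum (2 * l + 1) = -∑ i ∈ range l, (-1 : ℝ) ^ i / (((0 : ℕ) : ℝ) + i + 1) := by
  induction l with
  | zero => simp [reLogSum]
  | succ l ih =>
    have e : reLogSum (2 * (l + 1) + 1) = reLogSum (2 * l + 1) +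
        2 * (Complex.I ^ (2 * l + 1 + 1)).re / (((2 * l + 1 : ℕ) : ℝ) + 1) +
        2 * (Complex.I ^ (2 * l + 1 + 1 + 1)).re / (((2 * l + 1 + 1 : ℕ) : ℝ) + 1) := by
      rw [reLogSum, show 2 * (l + 1) + 1 = 2 * l + 1 + 1 + 1 by ring, sum_range_succ,
        sum_range_succ, ← reLogSum]
    rw [e, ih, sum_range_succ, pow_succ _ (2 * l + 1 + 1),
      show 2 * l + 1 + 1 = 2 * (l + 1) by ring, I_pow_two_mul, Complex.re_ofReal_mul,
      Complex.ofReal_re, Complex.I_re]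
    push_cast
    rw [pow_succ]
    field_simp
    ring

lemma neg_I_ne_one : -Complex.I ≠ 1 := fun h => by
  have := congrArg Complex.re h
  simp at this

lemma I_ne_one : Complex.I ≠ 1 := fun h => by
  have := congrArg Complex.re h
  simp at this

/-- `Li₁(i) + Li₁(-i) = -log 2`, read off along the odd truncations. -/
lemma add_eq_neg_alpha_zero {S T : ℂ} (hS : Tendsto (logSum Complex.I) atTop (𝓝 S))
    (hT : Tendsto (logSum (-Complex.I)) atTop (𝓝 T)) : S + T = ((-alpha 0 : ℝ) : ℂ) := by
  have h1 : Tendsto (fun l : ℕ => logSum Complex.I (2 * l + 1) + logSum (-Complex.I) (2 * l + 1))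
      atTop (𝓝 (S + T)) :=
    (hS.add hT).comp (tendsto_add_atTop_nat 1 |>.comp (tendsto_id.const_mul_atTop' (by norm_num)))
  refine tendsto_nhds_unique h1 ?_
  have h := (tendsto_sum_range_alternating 0).neg
  exact ((Complex.continuous_ofReal.tendsto _).comp h).congr fun l => by
    rw [logSum_I_add_logSum_neg_I, reLogSum_odd]
    rfl

lemma summable_norm_pow_div {z : ℂ} (hz : ‖z‖ = 1) {s : ℕ} (hs : 2 ≤ s) :
    Summable fun k : ℕ => ‖z ^ (k + 1) / ((k + 1 : ℕ) : ℂ) ^ s‖ := by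
  refine ((summable_nat_add_iff 1).2 (Real.summable_one_div_nat_pow.2 (by omega : 1 < s))).congr
    fun k => ?_
  rw [norm_div, norm_pow, norm_pow, hz, one_pow, Complex.norm_natCast]

lemma summable_pow_div_mul_harm {z : ℂ} (hz : ‖z‖ = 1) {s : ℕ} (hs : 2 ≤ s) :
    Summable fun k : ℕ => z ^ (k + 1) / ((k + 1 : ℕ) : ℂ) ^ s * (harm k : ℂ) := by
  refine Summable.of_norm_bounded (summable_sqrt_div_sq.mul_left 2) fun k => ?_
  rw [norm_mul, norm_div, norm_pow, norm_pow, hz, one_pow, Complex.norm_natCast, Complex.norm_real,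
    Real.norm_of_nonneg (harm_nonneg k)]
  have h0 : (0 : ℝ) ≤ k := Nat.cast_nonneg k
  have h1 : harm k ≤ 2 * √((k : ℝ) + 1) :=
    (harm_le_two_mul_sqrt k).trans (by gcongr; linarith)
  have h2 : 1 / ((k + 1 : ℕ) : ℝ) ^ s ≤ 1 / ((k : ℝ) + 1) ^ 2 := by
    push_cast
    gcongr
    · linarith
  calc 1 / ((k + 1 : ℕ) : ℝ) ^ s * harm k ≤ 1 / ((k : ℝ) + 1) ^ 2 * (2 * √((k : ℝ) + 1)) :=
        mul_le_mul h2 h1 (harm_nonneg k) (by positivity)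
    _ = _ := by ring

lemma tendsto_nestedSum_harm {z : ℂ} (hz : ‖z‖ = 1) {s : ℕ} (hs : 2 ≤ s) :
    Tendsto (nestedSum (polylogTerms [(s, z), (1, 1)])) atTop
      (𝓝 (∑' k : ℕ, z ^ (k + 1) / ((k + 1 : ℕ) : ℂ) ^ s * (harm k : ℂ))) := by
  refine (summable_pow_div_mul_harm hz hs).hasSum.tendsto_sum_nat.congr fun N => ?_
  rw [polylogTerms, List.map_cons, List.map_cons, List.map_nil, nestedSum_pair]
  refine sum_congr rfl fun n _ => ?_
  rw [harm]
  push_cast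
  simp

/-- A depth two polylogarithm whose outer series is conditionally convergent. -/
lemma tendsto_nestedSum_polylog {x y S : ℂ} (hx : Tendsto (logSum x) atTop (𝓝 S)) (hy : ‖y‖ = 1)
    {s : ℕ} (hs : 2 ≤ s) :
    Summable (fun k : ℕ => y ^ (k + 1) / ((k + 1 : ℕ) : ℂ) ^ s * (S - logSum x (k + 1))) ∧
      Tendsto (nestedSum (polylogTerms [(1, x), (s, y)])) atTop
        (𝓝 (∑' k : ℕ, y ^ (k + 1) / ((k + 1 : ℕ) : ℂ) ^ s * (S - logSum x (k + 1)))) :=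
  tendsto_nestedSum_pair (f := fun n => x ^ n / (n : ℂ) ^ 1) (g := fun n => y ^ n / (n : ℂ) ^ s)
    hx (summable_norm_pow_div hy hs)

lemma summable_and_dirichletBeta_eq_tsum {s : ℕ} (hs : 2 ≤ s) :
    Summable (fun l : ℕ => (-1 : ℝ) ^ l / (2 * (l : ℝ) + 1) ^ s) ∧
      dirichletBeta s = ∑' l : ℕ, (-1 : ℝ) ^ l / (2 * (l : ℝ) + 1) ^ s := by
  have h : Summable (fun l : ℕ => (-1 : ℝ) ^ l / (2 * (l : ℝ) + 1) ^ s) :=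
    summable_div_odd_pow (C := 1) hs fun l => by
      rw [abs_pow, abs_neg, abs_one, one_pow, one_mul]
      exact Real.one_le_sqrt.2 (by linarith [(Nat.cast_nonneg l : (0 : ℝ) ≤ l)])
  exact ⟨h, tendsto_nhds_unique (tendsto_betaSum s (by omega)) h.hasSum.tendsto_sum_nat⟩

lemma summable_alternating_harm {s : ℕ} (hs : 2 ≤ s) :
    Summable fun l : ℕ => (-1 : ℝ) ^ l * harm l / (2 * (l : ℝ) + 1) ^ s :=
  summable_div_odd_pow (C := 2) hs fun l => by
    rw [abs_mul, abs_pow, abs_neg, abs_one, one_pow, one_mul, abs_of_nonneg (harm_nonneg l)]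
    exact (harm_le_two_mul_sqrt l).trans (by gcongr; linarith)

lemma summable_alpha_div {s : ℕ} (hs : 2 ≤ s) :
    Summable fun l : ℕ => alpha l / (2 * (l : ℝ) + 1) ^ s :=
  summable_div_odd_pow (C := 1) hs fun l => by
    have h0 : (0 : ℝ) ≤ l := Nat.cast_nonneg l
    rw [one_mul, abs_of_nonneg (alpha_nonneg l)]
    refine (alpha_le l).trans ?_
    have h1 : 1 ≤ √((l : ℝ) + 1) := Real.one_le_sqrt.2 (by linarith)
    have h2 : 1 / ((l : ℝ) + 1) ≤ 1 := by
      rw [div_le_one (by positivity)]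
      linarith
    linarith

/-- The imaginary part of the four depth two polylogarithms as single series over odd `k = 2l+1`. -/
theorem im_polylog_eq {m : ℕ} (hm : 1 ≤ m) :
    (Li₂ 1 (m + 1) (-1) Complex.I + Li₂ (m + 1) 1 (-Complex.I) 1 +
      Li₂ 1 (m + 1) Complex.I (-Complex.I) + Li₂ 1 (m + 1) (-Complex.I) (-Complex.I)).im =
      dirichletBeta (m + 2) - alpha 0 * dirichletBeta (m + 1) -
        ∑' l : ℕ, (-1 : ℝ) ^ l * harm l / (2 * (l : ℝ) + 1) ^ (m + 1) +
        ∑' l : ℕ, alpha l / (2 * (l : ℝ) + 1) ^ (m + 1) := by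
  have hs : 2 ≤ m + 1 := by omega
  have hnI : ‖-Complex.I‖ = 1 := by rw [norm_neg, Complex.norm_I]
  obtain ⟨S, hS⟩ := exists_tendsto_logSum Complex.norm_I I_ne_one
  obtain ⟨T, hT⟩ := exists_tendsto_logSum hnI neg_I_ne_one
  have hST := add_eq_neg_alpha_zero hS hT
  obtain ⟨s1, t1⟩ := tendsto_nestedSum_polylog tendsto_logSum_neg_one Complex.norm_I hs
  have s2 := summable_pow_div_mul_harm hnI hs
  have t2 := tendsto_nestedSum_harm hnI hs
  obtain ⟨s3, t3⟩ := tendsto_nestedSum_polylog hS hnI hs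
  obtain ⟨s4, t4⟩ := tendsto_nestedSum_polylog hT hnI hs
  rw [Li₂, Li₂, Li₂, Li₂, nestedLim_eq t1, nestedLim_eq t2, nestedLim_eq t3, nestedLim_eq t4,
    ← s1.tsum_add s2, ← (s1.add s2).tsum_add s3, ← ((s1.add s2).add s3).tsum_add s4,
    Complex.im_tsum (((s1.add s2).add s3).add s4)]
  set t : ℕ → ℝ := fun k => (Complex.I ^ (k + 1) / ((k + 1 : ℕ) : ℂ) ^ (m + 1) *
        (((-alpha 0 : ℝ) : ℂ) - logSum (-1) (k + 1)) +
      (-Complex.I) ^ (k + 1) / ((k + 1 : ℕ) : ℂ) ^ (m + 1) * (harm k : ℂ) +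
      (-Complex.I) ^ (k + 1) / ((k + 1 : ℕ) : ℂ) ^ (m + 1) * (S - logSum Complex.I (k + 1)) +
      (-Complex.I) ^ (k + 1) / ((k + 1 : ℕ) : ℂ) ^ (m + 1) *
        (T - logSum (-Complex.I) (k + 1))).im with ht
  -- all the multipliers of the powers of `±i` are real
  have ht1 : ∀ k, t k = (Complex.I ^ (k + 1)).im / ((k : ℝ) + 1) ^ (m + 1) *
      ((-alpha 0 + ∑ i ∈ range (k + 1), (-1 : ℝ) ^ i / (((0 : ℕ) : ℝ) + i + 1)) - harm k +
        (alpha 0 + reLogSum (k + 1))) := by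
    intro k
    have hr : ((k + 1 : ℕ) : ℂ) ^ (m + 1) = ((((k : ℝ) + 1) ^ (m + 1) : ℝ) : ℂ) := by push_cast; rfl
    have hc : (-Complex.I) ^ (k + 1) = (starRingEnd ℂ) (Complex.I ^ (k + 1)) := by
      rw [map_pow, Complex.conj_I]
    have hsum : (S - logSum Complex.I (k + 1)) + (T - logSum (-Complex.I) (k + 1)) =
        ((-alpha 0 - reLogSum (k + 1) : ℝ) : ℂ) := by
      have h1 := logSum_I_add_logSum_neg_I (k + 1)
      push_cast at hST ⊢
      linear_combination hST - h1
    rw [ht]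
    dsimp only
    rw [add_assoc (_ + _), ← mul_add, hsum, logSum_neg_one, hr, hc, ← Complex.ofReal_sub]
    simp only [Complex.add_im, Complex.im_mul_ofReal, Complex.div_ofReal_im, Complex.conj_im]
    ring
  have hodd : ∀ l, t (2 * l + 1) = 0 := fun l => by
    rw [ht1, show 2 * l + 1 + 1 = 2 * (l + 1) by ring, I_pow_two_mul, Complex.ofReal_im]
    ring
  have heven : ∀ l : ℕ, t (2 * l) = (-1 : ℝ) ^ l / (2 * (l : ℝ) + 1) ^ (m + 2) -
      alpha 0 * ((-1 : ℝ) ^ l / (2 * (l : ℝ) + 1) ^ (m + 1)) -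
      (-1 : ℝ) ^ l * harm l / (2 * (l : ℝ) + 1) ^ (m + 1) +
      alpha l / (2 * (l : ℝ) + 1) ^ (m + 1) := fun l => by
    have h1 := sum_range_odd_alternating l
    have h2 := reLogSum_odd l
    rw [sum_range_alternating_eq_alpha, zero_add] at h2
    have h3 : harm (2 * l + 1) = harm (2 * l) + 1 / (2 * (l : ℝ) + 1) := by
      rw [harm, sum_range_succ, ← harm]
      push_cast
      rfl
    have h4 : (-1 : ℝ) ^ l * (-1) ^ l = 1 := by rw [← mul_pow]; norm_num
    rw [neg_eq_iff_eq_neg] at h1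
    rw [ht1, h1, h2, h3, pow_succ, I_pow_two_mul, Complex.im_ofReal_mul,
      Complex.I_im, pow_succ _ (m + 1)]
    push_cast
    field_simp
    linear_combination (alpha l * (2 * (l : ℝ) + 1)) * h4
  have hsupp : Function.support t ⊆ Set.range fun l : ℕ => 2 * l := by
    intro k hk
    rcases Nat.even_or_odd' k with ⟨l, rfl | rfl⟩
    · exact ⟨l, rfl⟩
    · exact absurd (hodd l) hk
  have hinj : Function.Injective fun l : ℕ => 2 * l := fun a b h => by
    dsimp only at h
    omega
  obtain ⟨b2s, b2⟩ := summable_and_dirichletBeta_eq_tsum (s := m + 2) (by omega)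
  obtain ⟨b1s, b1⟩ := summable_and_dirichletBeta_eq_tsum hs
  rw [← hinj.tsum_eq hsupp, b2, b1, ← tsum_mul_left, ← b2s.tsum_sub (b1s.mul_left _),
    ← (b2s.sub (b1s.mul_left _)).tsum_sub (summable_alternating_harm hs),
    ← ((b2s.sub (b1s.mul_left _)).sub (summable_alternating_harm hs)).tsum_add
      (summable_alpha_div hs)]
  exact tsum_congr heven

/-! ### The evaluation -/

/-- The antiderivative signs match the powers of `i` in the evaluation. -/
lemma axisSign_eq (m : ℕ) :
    (axisSign m : ℂ) = (if Even m then Complex.I else 1) * (-Complex.I) * Complex.I ^ m := by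
  induction m with
  | zero => simp [axisSign]
  | succ m ih =>
    rw [axisSign]
    push_cast
    rw [ih]
    rcases Nat.even_or_odd m with hm | hm
    · rw [if_pos hm, if_neg (Nat.not_even_iff_odd.2 hm.add_one), hm.neg_one_pow, pow_succ]
      ring
    · rw [if_neg (Nat.not_even_iff_odd.2 hm), if_pos hm.add_one, hm.neg_one_pow, pow_succ]
      linear_combination (Complex.I * Complex.I ^ m) * Complex.I_sq

lemma nestedSum_polylog_one (s : ℕ) (x : ℂ) (N : ℕ) :
    nestedSum (polylogTerms [(s, x)]) N = ∑ n ∈ range N, x ^ (n + 1) / ((n + 1 : ℕ) : ℂ) ^ s := by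
  rw [polylogTerms, List.map_cons, List.map_nil, nestedSum_singleton]

lemma tendsto_polylog_one_neg_one :
    Tendsto (nestedSum (polylogTerms [(1, -1)])) atTop (𝓝 (-alpha 0 : ℝ)) :=
  tendsto_logSum_neg_one.congr fun N => (nestedSum_polylog_one 1 (-1) N).symm

lemma tendsto_polylog_of_two_le {s : ℕ} (hs : 2 ≤ s) {x : ℂ} (hx : ‖x‖ = 1) :
    Tendsto (nestedSum (polylogTerms [(s, x)])) atTop
      (𝓝 (∑' n : ℕ, x ^ (n + 1) / ((n + 1 : ℕ) : ℂ) ^ s)) :=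
  (summable_norm_pow_div hx hs).of_norm.hasSum.tendsto_sum_nat.congr fun N =>
    (nestedSum_polylog_one s x N).symm

lemma nestedConverges_polylog_neg_one (p : ℕ) :
    NestedConverges (polylogTerms [(p + 1, -1)]) := by
  rcases Nat.eq_zero_or_pos p with rfl | hp
  · exact ⟨_, tendsto_polylog_one_neg_one⟩
  · exact ⟨_, tendsto_polylog_of_two_le (by omega) (by simp)⟩

lemma Li₁_one_neg_one : Li₁ 1 (-1) = ((-alpha 0 : ℝ) : ℂ) :=
  nestedLim_eq tendsto_polylog_one_neg_one

lemma Li₁_neg_one_sub_Li₁_one {s : ℕ} (hs : 2 ≤ s) :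
    Li₁ s (-1) - Li₁ s 1 = ((-2 * oddZeta s : ℝ) : ℂ) := by
  have s1 := (summable_norm_pow_div (z := -1) (by simp) hs).of_norm
  have s2 := (summable_norm_pow_div (z := 1) (by simp) hs).of_norm
  rw [Li₁, Li₁, nestedLim_eq (tendsto_polylog_of_two_le hs (by simp)),
    nestedLim_eq (tendsto_polylog_of_two_le hs (by simp)), ← s1.tsum_sub s2]
  have hinj : Function.Injective fun l : ℕ => 2 * l := fun a b h => by
    dsimp only at h
    omega
  rw [← hinj.tsum_eq]
  · rw [oddZeta, ← tsum_mul_left, Complex.ofReal_tsum]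
    refine tsum_congr fun l => ?_
    rw [pow_succ, pow_mul]
    push_cast
    norm_num
    ring
  · intro k hk
    rcases Nat.even_or_odd' k with ⟨l, rfl | rfl⟩
    · exact ⟨l, rfl⟩
    · refine absurd ?_ hk
      beta_reduce
      rw [show 2 * l + 1 + 1 = 2 * (l + 1) by ring, pow_mul]
      norm_num

/-- The products of beta values with `Li_{p+1}(±1)`, with the term `p = 0` split off; for `p ≥ 1`
only odd `n` contribute to `Li_{p+1}(-1) - Li_{p+1}(1)`. -/
lemma sum_beta_mul_Li (b : ℕ) :
    ∑ q ∈ antidiagonal (b + 1), 2 * (-1) ^ (1 + q.1) * (dirichletBeta (q.2 + 1) : ℂ) *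
        (Li₁ (q.1 + 1) (-1) - (if 1 ≤ q.1 then Li₁ (q.1 + 1) 1 else 0)) =
      ((2 * alpha 0 * dirichletBeta (b + 2) + 4 * ∑ q ∈ antidiagonal b,
        (-1) ^ (q.1 + 1) * dirichletBeta (q.2 + 1) * oddZeta (q.1 + 2) : ℝ) : ℂ) := by
  rw [Nat.sum_antidiagonal_succ, mul_sum]
  push_cast
  congr 1
  · simp only [Li₁_one_neg_one]
    norm_num
    ring
  · refine sum_congr rfl fun q _ => ?_
    rw [Li₁_neg_one_sub_Li₁_one (by omega)]
    push_cast
    ring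

/-- The moments of the odd cosines, summed against `α`, in terms of beta values. -/
lemma tsum_alpha_mul_cosMoment {m : ℕ} (hm : 1 ≤ m) :
    -4 * Complex.I * ∑' l : ℕ, (alpha l : ℂ) *
        (Complex.I ^ m * (cosMoment m l : ℂ) / (m.factorial : ℂ)) =
      (∑ a ∈ antidiagonal m, ∑ b ∈ antidiagonal a.2, 4 * Complex.I * (-1) ^ (b.1 + 1) *
        (dirichletBeta (b.2 + 1) : ℂ) * (dirichletBeta (b.1 + 1) : ℂ) *
          (1 / (a.1.factorial : ℂ)) * (Complex.I * (Real.pi : ℂ) / 2) ^ a.1) -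
      2 * (1 - (-1) ^ m) * ((∑' l : ℕ, alpha l / (2 * (l : ℝ) + 1) ^ (m + 1) : ℝ) : ℂ) := by
  have hq : ∀ q ∈ antidiagonal m, Summable fun l : ℕ =>
      (Complex.I * Real.pi / 2) ^ q.1 / (q.1.factorial : ℂ) * ((1 + (-1) ^ q.2) / 2) *
        (((-1) ^ l / (2 * (l : ℝ) + 1) ^ (q.2 + 1) * alpha l : ℝ) : ℂ) := fun q _ =>
    (Complex.ofRealCLM.summable (summable_alternating_alpha q.2)).mul_left _
  have ha : Summable fun l : ℕ => Complex.I / 2 * (1 - (-1) ^ m) *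
      ((alpha l / (2 * (l : ℝ) + 1) ^ (m + 1) : ℝ) : ℂ) :=
    (Complex.ofRealCLM.summable (summable_alpha_div (by omega))).mul_left _
  have e : ∀ l : ℕ, (alpha l : ℂ) * (Complex.I ^ m * (cosMoment m l : ℂ) / (m.factorial : ℂ)) =
      ∑ q ∈ antidiagonal m, (Complex.I * Real.pi / 2) ^ q.1 / (q.1.factorial : ℂ) *
        ((1 + (-1) ^ q.2) / 2) * (((-1) ^ l / (2 * (l : ℝ) + 1) ^ (q.2 + 1) * alpha l : ℝ) : ℂ) -
      Complex.I / 2 * (1 - (-1) ^ m) * ((alpha l / (2 * (l : ℝ) + 1) ^ (m + 1) : ℝ) : ℂ) := by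
    intro l
    rw [I_pow_mul_cosMoment, mul_sub, mul_sum, mul_sum]
    push_cast
    congr 1
    · refine sum_congr rfl fun q _ => ?_
      ring
    · ring
  simp_rw [e]
  rw [(summable_sum hq).tsum_sub ha, Summable.tsum_finsetSum hq, mul_sub, tsum_mul_left, mul_sum,
    ← Complex.ofReal_tsum]
  congr 1
  · refine sum_congr rfl fun q _ => ?_
    have h := congrArg (fun x : ℝ => (x : ℂ)) (sum_antidiagonal_beta_mul_beta q.2)
    rw [Complex.ofReal_mul] at h
    rw [tsum_mul_left, ← Complex.ofReal_tsum]
    have h2 : -4 * Complex.I * ((Complex.I * Real.pi / 2) ^ q.1 / (q.1.factorial : ℂ) *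
        ((1 + (-1) ^ q.2) / 2) *
        ((∑' l : ℕ, (-1) ^ l / (2 * (l : ℝ) + 1) ^ (q.2 + 1) * alpha l : ℝ) : ℂ)) =
        -4 * Complex.I * ((Complex.I * Real.pi / 2) ^ q.1 / (q.1.factorial : ℂ)) *
        ((((1 + (-1) ^ q.2) / 2 : ℝ) : ℂ) *
        ((∑' l : ℕ, (-1) ^ l / (2 * (l : ℝ) + 1) ^ (q.2 + 1) * alpha l : ℝ) : ℂ)) := by
      push_cast
      ring
    rw [h2, ← h]
    push_cast
    rw [mul_sum]
    refine sum_congr rfl fun b _ => ?_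
    ring
  · linear_combination (-2 * (1 - (-1) ^ m) *
      ((∑' l : ℕ, alpha l / (2 * (l : ℝ) + 1) ^ (m + 1) : ℝ) : ℂ)) * Complex.I_sq

/-- The remaining terms of the evaluation: everything cancels except for a multiple of
`∑ α_l / (2l+1)^(m+1)`, with `m = b + 1`. -/
lemma sum_beta_mul_Li_add (b : ℕ) :
    2 * alpha 0 * dirichletBeta (b + 2) + 4 * (∑ q ∈ antidiagonal b,
        (-1) ^ (q.1 + 1) * dirichletBeta (q.2 + 1) * oddZeta (q.1 + 2)) +
      2 * dirichletBeta (b + 3) - 2 * (dirichletBeta (b + 3) - alpha 0 * dirichletBeta (b + 2) -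
        ∑' l : ℕ, (-1 : ℝ) ^ l * harm l / (2 * (l : ℝ) + 1) ^ (b + 2) +
        ∑' l : ℕ, alpha l / (2 * (l : ℝ) + 1) ^ (b + 2)) =
      -2 * (1 - (-1) ^ (b + 1)) * ∑' l : ℕ, alpha l / (2 * (l : ℝ) + 1) ^ (b + 2) := by
  obtain ⟨bs, hb⟩ := summable_and_dirichletBeta_eq_tsum (s := b + 2) (by omega)
  have hE := summable_alternating_harm (s := b + 2) (by omega)
  have e1 : ∑' l : ℕ, 1 / (2 * (l : ℝ) + 1) ^ (b + 2) * alpha l =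
      ∑' l : ℕ, alpha l / (2 * (l : ℝ) + 1) ^ (b + 2) := tsum_congr fun l => by ring
  have e2 : ∑' l : ℕ, (-1) ^ l / (2 * (l : ℝ) + 1) ^ (b + 2) * (alpha 0 + harm l / 2) =
      alpha 0 * dirichletBeta (b + 2) +
        1 / 2 * ∑' l : ℕ, (-1 : ℝ) ^ l * harm l / (2 * (l : ℝ) + 1) ^ (b + 2) := by
    rw [hb, ← tsum_mul_left, ← tsum_mul_left, ← (bs.mul_left _).tsum_add (hE.mul_left _)]
    exact tsum_congr fun l => by ring
  rw [sum_antidiagonal_beta_mul_oddZeta, e1, e2]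
  ring

end MixedValues

theorem mainTheorem5 (m : ℕ) (hm : 1 ≤ m) :
    -- all the series in the formula converge
    (NestedConverges (altTTerms (index21 m)) ∧
      (∀ s : ℕ, 1 ≤ s → NestedConverges [betaTerm s]) ∧
      (∀ p : ℕ, NestedConverges (polylogTerms [(p + 1, -1)])) ∧
      (∀ p : ℕ, 1 ≤ p → NestedConverges (polylogTerms [(p + 1, 1)])) ∧
      NestedConverges (polylogTerms [(1, -1), (m + 1, Complex.I)]) ∧
      NestedConverges (polylogTerms [(m + 1, -Complex.I), (1, 1)]) ∧
      NestedConverges (polylogTerms [(1, Complex.I), (m + 1, -Complex.I)]) ∧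
      NestedConverges (polylogTerms [(1, -Complex.I), (m + 1, -Complex.I)])) ∧
    -- the evaluation
    (altT (index21 m) : ℂ) =
      (if Even m then Complex.I else 1) *
        ((∑ a ∈ Finset.HasAntidiagonal.antidiagonal m, ∑ b ∈ Finset.HasAntidiagonal.antidiagonal a.2,
            -- here `k = a.1`, `p = b.1`, `r = b.2`
            4 * Complex.I * (-1) ^ (b.1 + 1) *
              (dirichletBeta (b.2 + 1) : ℂ) * (dirichletBeta (b.1 + 1) : ℂ) *
              (1 / (a.1.factorial : ℂ)) * (Complex.I * (Real.pi : ℂ) / 2) ^ a.1)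
          + (∑ b ∈ Finset.HasAntidiagonal.antidiagonal m,
              -- here `p = b.1`, `r = b.2`
              2 * (-1) ^ (1 + b.1) * (dirichletBeta (b.2 + 1) : ℂ) *
                (Li₁ (b.1 + 1) (-1) - (if 1 ≤ b.1 then Li₁ (b.1 + 1) 1 else 0)))
          + 2 * (dirichletBeta (m + 2) : ℂ)
          - 2 * (((Li₂ 1 (m + 1) (-1) Complex.I + Li₂ (m + 1) 1 (-Complex.I) 1
              + Li₂ 1 (m + 1) Complex.I (-Complex.I)
              + Li₂ 1 (m + 1) (-Complex.I) (-Complex.I)).im : ℝ) : ℂ)) := by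
  obtain ⟨b, rfl⟩ := Nat.exists_eq_add_of_le' hm
  have hnI : ‖-Complex.I‖ = 1 := by rw [norm_neg, Complex.norm_I]
  have hs : 2 ≤ b + 1 + 1 := by omega
  obtain ⟨S, hS⟩ := exists_tendsto_logSum Complex.norm_I I_ne_one
  obtain ⟨T, hT⟩ := exists_tendsto_logSum hnI neg_I_ne_one
  refine ⟨⟨⟨_, tendsto_nestedSum_index21 b⟩, nestedConverges_betaTerm,
    nestedConverges_polylog_neg_one,
    fun p hp => ⟨_, tendsto_polylog_of_two_le (by omega) (by simp)⟩,
    ⟨_, (tendsto_nestedSum_polylog tendsto_logSum_neg_one Complex.norm_I hs).2⟩,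
    ⟨_, tendsto_nestedSum_harm hnI hs⟩,
    ⟨_, (tendsto_nestedSum_polylog hS hnI hs).2⟩,
    ⟨_, (tendsto_nestedSum_polylog hT hnI hs).2⟩⟩, ?_⟩
  have h1 := tsum_alpha_mul_cosMoment hm
  have hT1 : (altT (index21 (b + 1)) : ℂ) = (if Even (b + 1) then Complex.I else 1) *
      (-4 * Complex.I * ∑' l : ℕ, (alpha l : ℂ) *
        (Complex.I ^ (b + 1) * (cosMoment (b + 1) l : ℂ) / ((b + 1).factorial : ℂ))) := by
    have e : ∀ l : ℕ, (alpha l : ℂ) *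
        (Complex.I ^ (b + 1) * (cosMoment (b + 1) l : ℂ) / ((b + 1).factorial : ℂ)) =
        Complex.I ^ (b + 1) / ((b + 1).factorial : ℂ) *
          ((alpha l * cosMoment (b + 1) l : ℝ) : ℂ) := fun l => by push_cast; ring
    simp_rw [e]
    rw [tsum_mul_left, ← Complex.ofReal_tsum, altT_index21, Complex.ofReal_mul, axisSign_eq]
    push_cast
    ring
  rw [hT1, h1, sum_beta_mul_Li, im_polylog_eq hm]
  congr 1
  have h4 := congrArg (fun x : ℝ => (x : ℂ)) (sum_beta_mul_Li_add b)
  push_cast at h4 ⊢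
  linear_combination -h4
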